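/- Let $\{\xi_i\}_{i\ge 0}$ be a centered stationary Gaussian sequence with $\mathbb{E}\,\xi_i^2=1$ and non-negative correlation function $\rho(i):=\mathbb{E}\,\xi_0\xi_i$, extended to $\mathbb{Z}$ by $\rho(-i)=\rho(i)$, and suppose that $\sum_{i=0}^\infty\rho(i)<\infty$. Let $\alpha>0$, $\sigma(i)=e^{\alpha i}$, $S_\ell:=\sum_{i=1}^{\ell}\sigma(i)\xi_i$ and $q_n:=\mathbb{P}(\max_{1\le \ell\le n}S_\ell<0)$. Put $$D_{\alpha,\rho}(\tau):=\frac{\sum_{i,j=0}^\infty e^{-(i+j)\alpha}\rho(i-j-\tau)}{\sum_{i,j=0}^\infty e^{-(i+j)\alpha}\rho(i-j)},\qquad \tau\in\mathbb{Z}.$$ Then $D_{\alpha,\rho}$ is the correlation function of a centered stationary Gaussian sequence of unit variance; for any such sequence $\{Z_\alpha(\ell)\}$ the limit $$\theta_d(D_{\alpha,\rho}):=-\lim_{n\to\infty}\frac1n\log\mathbb{P}\Big(\max_{1\le \ell\le n}Z_\alpha(\ell)<0\Big)$$ exists, depends only on $D_{\alpha,\rho}$, and lies in $(0,\infty)$;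 and $$\lim_{n\to\infty}\frac{\log q_n}{n}=-\theta_d(D_{\alpha,\rho}).$$ Moreover the exponent depends on both $\alpha$ and $\rho$: for all $\alpha$ and $\rho$ as above there is an $\alpha'>0$ with $\theta_d(D_{\alpha',\rho})\neq\theta_d(D_{\alpha,\rho})$, and there is a non-negative summable correlation function $\rho'$ of a centered stationary Gaussian sequence of unit variance with $\theta_d(D_{\alpha,\rho'})\neq\theta_d(D_{\alpha,\rho})$. -/

import Mathlib

open MeasureTheory ProbabilityTheory Filter Topology

universe u v

/-- `X 0, X 1, X 2, …` is a centered stationary Gaussian sequence with unit variance and correlation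
function `A`, that is, `E (X i * X j) = A (i - j)` for all `i j : ℕ`; in particular `A` is even.
(For a centered Gaussian sequence this is the same as invariance of the law under shifts.) -/
structure IsStationaryGaussianSeq {Ω : Type*} [MeasurableSpace Ω] (P : Measure Ω)
    (X : ℕ → Ω → ℝ) (A : ℤ → ℝ) : Prop where
  gaussian : IsGaussianProcess X P
  centered : ∀ i, ∫ ω, X i ω ∂P = 0
  unit_variance : A 0 = 1
  covariance : ∀ i j : ℕ, ∫ ω, X i ω * X j ω ∂P = A ((i : ℤ) - (j : ℤ))

/-- `A` is the correlation function of some centered stationary Gaussian sequence. -/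
def IsCorrelationFunction (A : ℤ → ℝ) : Prop :=
  ∃ (Ω : Type) (_ : MeasurableSpace Ω) (P : Measure Ω) (_ : IsProbabilityMeasure P)
    (X : ℕ → Ω → ℝ), IsStationaryGaussianSeq P X A

/-- The persistence probability `P (max_{1 ≤ ℓ ≤ n} X ℓ < 0)`. -/
noncomputable def persistenceProb {Ω : Type*} [MeasurableSpace Ω] (P : Measure Ω)
    (X : ℕ → Ω → ℝ) (n : ℕ) : ℝ :=
  P.real {ω | ∀ ℓ ∈ Finset.Icc 1 n, X ℓ ω < 0}

/-- The weighted sum `S ℓ = ∑_{i=1}^ℓ σ i * ξ i`. -/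
noncomputable def weightedSum {Ω : Type*} (σ : ℕ → ℝ) (ξ : ℕ → Ω → ℝ) (ℓ : ℕ) (ω : Ω) : ℝ :=
  ∑ i ∈ Finset.Icc 1 ℓ, σ i * ξ i ω

/-- The function
`D (τ) = ∑_{i,j ≥ 0} e^{-(i+j)α} ρ (i-j-τ) / ∑_{i,j ≥ 0} e^{-(i+j)α} ρ (i-j)`. -/
noncomputable def expCorr (α : ℝ) (ρ : ℤ → ℝ) (τ : ℤ) : ℝ :=
  (∑' p : ℕ × ℕ, Real.exp (-((p.1 : ℝ) + (p.2 : ℝ)) * α) * ρ ((p.1 : ℤ) - (p.2 : ℤ) - τ)) /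
    (∑' p : ℕ × ℕ, Real.exp (-((p.1 : ℝ) + (p.2 : ℝ)) * α) * ρ ((p.1 : ℤ) - (p.2 : ℤ)))

/-- `θ` is the discrete persistence exponent of the correlation function `A`: there is a centered
stationary Gaussian sequence with correlation function `A`, and for every such sequence `Z`,
`-lim_{n → ∞} (1 / n) * log P (max_{1 ≤ ℓ ≤ n} Z ℓ < 0)` exists and equals `θ`. -/
def HasPersistenceExponent (A : ℤ → ℝ) (θ : ℝ) : Prop :=
  IsCorrelationFunction A ∧
    ∀ (Ω : Type v) [MeasurableSpace Ω] (P : Measure Ω) [IsProbabilityMeasure P] (Z : ℕ → Ω → ℝ),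
      IsStationaryGaussianSeq P Z A →
        Tendsto (fun n : ℕ => -(1 / (n : ℝ) * Real.log (persistenceProb P Z n))) atTop (𝓝 θ)

/-! Divided by `exp (α * ℓ)`, the sum S_ℓ becomes a truncated exponential moving average of ξ.
Reversing time turns these into truncations of Y_m = ∑_a e^{-aα} ξ_{m+a} (`expAverage`), whose
normalization is stationary with correlation `expCorr α ρ`. Let p_n and q_n be the persistence
probabilities of Y and S. As ρ ≥ 0, all covariances are non-negative, and Slepian's inequality makes
the negativity events of separate blocks positively associated (`mul_le_measureReal_neg`).

Association gives p_{m+n} ≥ p_m p_n, so Fekete's lemma produces the exponent as an infimum. It is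
positive because along a sparse progression the covariance matrix is diagonally dominant: an
independent white noise can be split off, and conditioning on the rest yields an exponential bound
(`exists_measureReal_neg_le_pow`).

For the transfer to S, what the truncation removes from each average is a positive multiple of one
common variable Y_{n+1}; association gives q_n P(Y_{n+1} < 0) ≤ p_n. Conversely, a late block of N
sums has persistence probability close to p_N, and association chains such blocks.

If A(k) ≥ e^{-kβ} with β small, the first N variables nearly coincide, and the infimum formula makes
the exponent small (`exists_forall_exponent_lt`). Shifting one summation index shows that `expCorr β
ρ` satisfies this bound, so α' = β changes the exponent. The bound survives a further transform with
parameter α, so ρ' = `expCorr β ρ` changes it too.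

Slepian's inequality is proved without differentiation: the covariance is raised in small steps,
each trading independent noise in two coordinates for shared noise, and Chebyshev's association
inequality gives the sign of each trade. -/

/-- `X` is a centered (possibly degenerate) Gaussian vector with covariance matrix `S`,
expressed through its characteristic function. -/
structure IsCenteredGaussianVector {Ω ι : Type*} [MeasurableSpace Ω] [Fintype ι] (P : Measure Ω)
    (X : ι → Ω → ℝ) (S : Matrix ι ι ℝ) : Prop where
  aemeasurable : ∀ i, AEMeasurable (X i) P
  symm : ∀ i j, S i j = S j i
  charFun : ∀ c : ι → ℝ, ∫ ω, Complex.exp ((∑ i, c i * X i ω : ℝ) * Complex.I) ∂P =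
    Complex.exp ((-(∑ i, ∑ j, c i * c j * S i j) / 2 : ℝ))

/-! ### Centered Gaussian vectors through characteristic functions -/

namespace IsCenteredGaussianVector

open Complex (I)

variable {Ω Ω' ι κ : Type*} [MeasurableSpace Ω] [MeasurableSpace Ω'] [Fintype ι] [Fintype κ]
  {P : Measure Ω} {P' : Measure Ω'} {X : ι → Ω → ℝ} {S T : Matrix ι ι ℝ}

lemma aemeasurable_sum (hX : IsCenteredGaussianVector P X S) (c : ι → ℝ) :
    AEMeasurable (fun ω => ∑ i, c i * X i ω) P :=
  Finset.aemeasurable_fun_sum _ fun i _ => (hX.aemeasurable i).const_mul (c i)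

lemma aemeasurable_pi (hX : IsCenteredGaussianVector P X S) :
    AEMeasurable (fun ω i => X i ω) P :=
  aemeasurable_pi_iff.2 hX.aemeasurable

/-- Linear images of centered Gaussian vectors. -/
lemma linear (hX : IsCenteredGaussianVector P X S) (A : κ → ι → ℝ) :
    IsCenteredGaussianVector P (fun k ω => ∑ i, A k i * X i ω)
      (fun k l => ∑ i, ∑ j, A k i * A l j * S i j) where
  aemeasurable k := hX.aemeasurable_sum (A k)
  symm k l := by
    rw [Finset.sum_comm]
    refine Finset.sum_congr rfl fun i _ => Finset.sum_congr rfl fun j _ => ?_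
    rw [hX.symm j i]; ring
  charFun c := by
    have h := hX.charFun (fun i => ∑ k, c k * A k i)
    have h1 : ∀ ω, ∑ i, (∑ k, c k * A k i) * X i ω = ∑ k, c k * ∑ i, A k i * X i ω := by
      intro ω
      simp_rw [Finset.sum_mul, Finset.mul_sum]
      rw [Finset.sum_comm]
      simp_rw [mul_assoc]
    have h2 : ∑ i, ∑ j, (∑ k, c k * A k i) * (∑ k, c k * A k j) * S i j
        = ∑ k, ∑ l, c k * c l * ∑ i, ∑ j, A k i * A l j * S i j := by
      have e : ∀ i j, (∑ k, c k * A k i) * (∑ k, c k * A k j) * S i j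
          = ∑ k, ∑ l, c k * c l * (A k i * A l j * S i j) := by
        intro i j
        rw [Finset.sum_mul_sum, Finset.sum_mul]
        refine Finset.sum_congr rfl fun k _ => ?_
        rw [Finset.sum_mul]
        exact Finset.sum_congr rfl fun l _ => by ring
      simp_rw [e, Finset.mul_sum]
      rw [Finset.sum_comm' (t' := Finset.univ) (s' := fun _ => Finset.univ) (by simp)]
      have e2 : ∀ j, ∑ i, ∑ k, ∑ l, c k * c l * (A k i * A l j * S i j)
        = ∑ k, ∑ l, ∑ i, c k * c l * (A k i * A l j * S i j) := by
        intro j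
        rw [Finset.sum_comm]
        exact Finset.sum_congr rfl fun k _ => Finset.sum_comm
      simp_rw [e2]
      rw [Finset.sum_comm]
      refine Finset.sum_congr rfl fun k _ => ?_
      rw [Finset.sum_comm]
      exact Finset.sum_congr rfl fun l _ => Finset.sum_comm
    simp_rw [h1, h2] at h
    exact h

lemma reindex (hX : IsCenteredGaussianVector P X S) (e : κ → ι) :
    IsCenteredGaussianVector P (fun k => X (e k)) (fun k l => S (e k) (e l)) := by
  classical
  have h := hX.linear (fun k i => if i = e k then 1 else 0)
  simpa using h

/-- A characteristic function has modulus at most 1, which forces the quadratic form to be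
non-negative; scaling the coefficients by `t` then recovers the whole characteristic function of the
linear combination. -/
lemma map_sum_eq_gaussianReal [IsProbabilityMeasure P] (hX : IsCenteredGaussianVector P X S)
    (c : ι → ℝ) :
    0 ≤ ∑ i, ∑ j, c i * c j * S i j ∧
    P.map (fun ω => ∑ i, c i * X i ω) =
      gaussianReal 0 (∑ i, ∑ j, c i * c j * S i j).toNNReal := by
  have h0 : 0 ≤ ∑ i, ∑ j, c i * c j * S i j := by
    have h := hX.charFun c
    have h1 : ‖∫ ω, Complex.exp ((∑ i, c i * X i ω : ℝ) * I) ∂P‖ ≤ 1 := by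
      refine (norm_integral_le_integral_norm _).trans ?_
      simp_rw [Complex.norm_exp_ofReal_mul_I]
      simp
    rw [h, ← Complex.ofReal_exp, Complex.norm_real, Real.norm_eq_abs, Real.abs_exp,
      Real.exp_le_one_iff] at h1
    linarith
  refine ⟨h0, ?_⟩
  have := Measure.isProbabilityMeasure_map (μ := P) (hX.aemeasurable_sum c)
  apply Measure.ext_of_charFun
  ext t
  rw [charFun_gaussianReal, charFun_apply_real, integral_map (hX.aemeasurable_sum c)
    (by fun_prop)]
  have h := hX.charFun (fun i => t * c i)
  have e1 : ∀ ω, ∑ i, t * c i * X i ω = t * ∑ i, c i * X i ω := fun ω => by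
    simp_rw [Finset.mul_sum, mul_assoc]
  have e : ∑ i, ∑ j, t * c i * (t * c j) * S i j = t ^ 2 * ∑ i, ∑ j, c i * c j * S i j := by
    simp_rw [Finset.mul_sum]
    exact Finset.sum_congr rfl fun i _ => Finset.sum_congr rfl fun j _ => by ring
  rw [e] at h
  simp_rw [e1, Complex.ofReal_mul t] at h
  rw [h]
  congr 1
  rw [show (((∑ i, ∑ j, c i * c j * S i j).toNNReal : ℝ) : ℂ)
    = ((∑ i, ∑ j, c i * c j * S i j : ℝ) : ℂ) by rw [Real.coe_toNNReal _ h0]]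
  push_cast; ring

lemma posSemidef [IsProbabilityMeasure P] (hX : IsCenteredGaussianVector P X S) :
    S.PosSemidef := by
  refine Matrix.PosSemidef.of_dotProduct_mulVec_nonneg ?_ fun c => ?_
  · ext i j; simp [hX.symm i j]
  · have := (hX.map_sum_eq_gaussianReal c).1
    simp only [dotProduct, Matrix.mulVec, star_trivial, Finset.mul_sum]
    simpa only [mul_assoc, mul_left_comm, mul_comm] using this

lemma integral_sum_sq [IsProbabilityMeasure P] (hX : IsCenteredGaussianVector P X S) (c : ι → ℝ) :
    ∫ ω, (∑ i, c i * X i ω) ^ 2 ∂P = ∑ i, ∑ j, c i * c j * S i j := by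
  obtain ⟨h0, h⟩ := hX.map_sum_eq_gaussianReal c
  have h1 : ∫ x, x ^ 2 ∂(P.map (fun ω => ∑ i, c i * X i ω)) = ∫ ω, (∑ i, c i * X i ω) ^ 2 ∂P :=
    integral_map (hX.aemeasurable_sum c) (by fun_prop)
  rw [← h1, h]
  have h2 := variance_id_gaussianReal (μ := 0) (v := (∑ i, ∑ j, c i * c j * S i j).toNNReal)
  rw [variance_of_integral_eq_zero (by fun_prop) (by simp)] at h2
  simpa [h0] using h2

lemma map_eq_gaussianReal [IsProbabilityMeasure P] (hX : IsCenteredGaussianVector P X S) (i : ι) :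
    P.map (X i) = gaussianReal 0 (S i i).toNNReal := by
  classical
  have h := (hX.map_sum_eq_gaussianReal (Pi.single i 1)).2
  simpa [Pi.single_apply] using h

lemma memLp_two [IsProbabilityMeasure P] (hX : IsCenteredGaussianVector P X S) (i : ι) :
    MemLp (X i) 2 P := by
  have : HasGaussianLaw (X i) P := ⟨by rw [hX.map_eq_gaussianReal i]; infer_instance⟩
  exact this.memLp_two

lemma integral_eq_zero [IsProbabilityMeasure P] (hX : IsCenteredGaussianVector P X S) (i : ι) :
    ∫ ω, X i ω ∂P = 0 := by
  have h1 : ∫ x, x ∂(P.map (X i)) = ∫ ω, X i ω ∂P :=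
    integral_map (hX.aemeasurable i) (by fun_prop)
  rw [← h1, hX.map_eq_gaussianReal i, integral_id_gaussianReal]

/-- Polarization of the second moments of linear combinations. -/
lemma integral_mul [IsProbabilityMeasure P] (hX : IsCenteredGaussianVector P X S) (i j : ι) :
    ∫ ω, X i ω * X j ω ∂P = S i j := by
  classical
  have hi := hX.integral_sum_sq (Pi.single i 1)
  have hj := hX.integral_sum_sq (Pi.single j 1)
  have hij := hX.integral_sum_sq (Pi.single i 1 + Pi.single j 1)
  simp [Pi.single_apply, add_mul, mul_add, Finset.sum_add_distrib] at hi hj hij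
  have hii : Integrable (fun ω => X i ω ^ 2) P := (hX.memLp_two i).integrable_sq
  have hjj : Integrable (fun ω => X j ω ^ 2) P := (hX.memLp_two j).integrable_sq
  have hm : Integrable (fun ω => X i ω * X j ω) P := (hX.memLp_two i).integrable_mul (hX.memLp_two j)
  have e : ∫ ω, (X i ω + X j ω) ^ 2 ∂P
      = ∫ ω, X i ω ^ 2 ∂P + 2 * ∫ ω, X i ω * X j ω ∂P + ∫ ω, X j ω ^ 2 ∂P := by
    rw [← integral_const_mul, ← integral_add hii (hm.const_mul 2), ← integral_add _ hjj]
    · congr 1; ext ω; ring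
    · exact hii.add (hm.const_mul 2)
  have := hX.symm i j
  linarith

/-- The law of a centered Gaussian vector. -/
lemma map_toLp_eq [DecidableEq ι] [IsProbabilityMeasure P] (hX : IsCenteredGaussianVector P X S) :
    P.map (fun ω => WithLp.toLp 2 (fun i => X i ω)) = multivariateGaussian 0 S := by
  have hm : AEMeasurable (fun ω => WithLp.toLp 2 (fun i => X i ω)) P :=
    (WithLp.measurable_toLp 2 _).comp_aemeasurable hX.aemeasurable_pi
  have := Measure.isProbabilityMeasure_map (μ := P) hm
  apply Measure.ext_of_charFun
  ext t
  rw [charFun_multivariateGaussian hX.posSemidef, charFun_apply, integral_map hm (by fun_prop)]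
  have h := hX.charFun (fun i => t i)
  simp only [PiLp.inner_apply, RCLike.inner_apply, conj_trivial]
  rw [h]
  simp only [dotProduct, Matrix.mulVec, Finset.mul_sum]
  simp [neg_div, mul_left_comm, mul_comm]

lemma hasGaussianLaw [IsProbabilityMeasure P] (hX : IsCenteredGaussianVector P X S) :
    HasGaussianLaw (fun ω i => X i ω) P := by
  classical
  have h : HasGaussianLaw (fun ω => WithLp.toLp 2 (fun i => X i ω)) P :=
    ⟨by rw [hX.map_toLp_eq]; infer_instance⟩
  exact h.map_equiv (PiLp.continuousLinearEquiv 2 ℝ (fun _ : ι => ℝ))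

/-- Centered Gaussian vectors with the same covariance matrix have the same law. -/
lemma map_pi_eq {X' : ι → Ω' → ℝ} [IsProbabilityMeasure P] [IsProbabilityMeasure P']
    (hX : IsCenteredGaussianVector P X S) (hX' : IsCenteredGaussianVector P' X' S) :
    P.map (fun ω i => X i ω) = P'.map (fun ω i => X' i ω) := by
  classical
  have h := hX.map_toLp_eq.trans hX'.map_toLp_eq.symm
  have h2 := congrArg (Measure.map (WithLp.ofLp)) h
  erw [AEMeasurable.map_map_of_aemeasurable (by fun_prop)
      ((WithLp.measurable_toLp 2 _).comp_aemeasurable hX.aemeasurable_pi),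
    AEMeasurable.map_map_of_aemeasurable (by fun_prop)
      ((WithLp.measurable_toLp 2 _).comp_aemeasurable hX'.aemeasurable_pi)] at h2
  exact h2

lemma integral_comp_eq {X' : ι → Ω' → ℝ} [IsProbabilityMeasure P] [IsProbabilityMeasure P']
    (hX : IsCenteredGaussianVector P X S) (hX' : IsCenteredGaussianVector P' X' S)
    {f : (ι → ℝ) → ℝ} (hf : Measurable f) :
    ∫ ω, f (fun i => X i ω) ∂P = ∫ ω, f (fun i => X' i ω) ∂P' := by
  rw [← integral_map hX.aemeasurable_pi hf.aestronglyMeasurable,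
    ← integral_map hX'.aemeasurable_pi hf.aestronglyMeasurable, hX.map_pi_eq hX']

/-- Every positive semidefinite matrix is the covariance matrix of a centered Gaussian vector. -/
lemma of_posSemidef [DecidableEq ι] (hS : S.PosSemidef) :
    IsCenteredGaussianVector (multivariateGaussian 0 S) (fun i x => x i) S where
  aemeasurable i := by fun_prop
  symm i j := by simpa using (hS.1.apply i j).symm
  charFun c := by
    have h := charFun_multivariateGaussian (μ := 0) hS (WithLp.toLp 2 c)
    rw [charFun_apply] at h
    simp only [PiLp.inner_apply, RCLike.inner_apply, conj_trivial] at h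
    rw [h]
    simp only [dotProduct, Matrix.mulVec, Finset.mul_sum]
    simp [neg_div, mul_left_comm, mul_comm]

/-- Two centered Gaussian vectors, made independent of each other. -/
lemma prod {X' : κ → Ω' → ℝ} {S' : Matrix κ κ ℝ} [IsProbabilityMeasure P] [IsProbabilityMeasure P']
    (hX : IsCenteredGaussianVector P X S) (hX' : IsCenteredGaussianVector P' X' S') :
    IsCenteredGaussianVector (P.prod P')
      (Sum.elim (fun i z => X i z.1) (fun k z => X' k z.2)) (Matrix.fromBlocks S 0 0 S') where
  aemeasurable := by
    rintro (i | k)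
    · exact (hX.aemeasurable i).comp_fst
    · exact (hX'.aemeasurable k).comp_snd
  symm := by
    rintro (i | k) (j | l)
    · simpa using hX.symm i j
    · simp
    · simp
    · simpa using hX'.symm k l
  charFun c := by
    simp only [Fintype.sum_sum_type, Sum.elim_inl, Sum.elim_inr, Matrix.fromBlocks_apply₁₁,
      Matrix.fromBlocks_apply₁₂, Matrix.fromBlocks_apply₂₁, Matrix.fromBlocks_apply₂₂,
      Matrix.zero_apply, mul_zero, Finset.sum_const_zero, add_zero, zero_add]
    have h1 := hX.charFun (fun i => c (Sum.inl i))
    have h2 := hX'.charFun (fun i => c (Sum.inr i))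
    simp_rw [Complex.ofReal_add, add_mul, Complex.exp_add]
    rw [integral_prod_mul (fun ω => Complex.exp ((∑ i, c (Sum.inl i) * X i ω : ℝ) * I))
      (fun ω => Complex.exp ((∑ i, c (Sum.inr i) * X' i ω : ℝ) * I)), h1, h2, ← Complex.exp_add]
    congr 1
    push_cast; ring

/-- The sum of two independent centered Gaussian vectors. -/
lemma add_prod {X' : ι → Ω' → ℝ} [IsProbabilityMeasure P] [IsProbabilityMeasure P']
    (hX : IsCenteredGaussianVector P X S) (hX' : IsCenteredGaussianVector P' X' T) :
    IsCenteredGaussianVector (P.prod P') (fun i z => X i z.1 + X' i z.2) (S + T) := by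
  classical
  have h := (hX.prod hX').linear (fun (k : ι) => Sum.elim (fun i => if i = k then 1 else 0)
    (fun i => if i = k then 1 else 0))
  simp [Fintype.sum_sum_type] at h
  exact h

lemma smul (hX : IsCenteredGaussianVector P X S) (a : ℝ) :
    IsCenteredGaussianVector P (fun i ω => a * X i ω) (a ^ 2 • S) := by
  classical
  have h := hX.linear (fun (k : ι) i => if i = k then a else 0)
  simp at h
  have e : a ^ 2 • S = fun k l => a * a * S k l := by
    ext i j
    rw [Matrix.smul_apply, smul_eq_mul, sq]
  rw [e]; exact h

/-- Finite-dimensional marginals of a centered Gaussian process. -/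
lemma of_isGaussianProcess {T : Type*} [IsProbabilityMeasure P] {Z : T → Ω → ℝ}
    (hZ : IsGaussianProcess Z P)
    (h0 : ∀ t, ∫ ω, Z t ω ∂P = 0) {K : T → T → ℝ} (hK : ∀ s t, ∫ ω, Z s ω * Z t ω ∂P = K s t)
    (e : ι → T) : IsCenteredGaussianVector P (fun i => Z (e i)) (fun i j => K (e i) (e j)) where
  aemeasurable i := hZ.aemeasurable (e i)
  symm i j := by rw [← hK, ← hK]; simp_rw [mul_comm]
  charFun c := by
    have hg : HasGaussianLaw (fun ω => ∑ i, c i * Z (e i) ω) P :=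
      ((hZ.comp_right e).smul c).hasGaussianLaw_fun_sum (I := Finset.univ)
    have hL : ∀ t, MemLp (Z t) 2 P := fun t => (hZ.hasGaussianLaw_eval t).memLp_two
    have hi : ∀ t, Integrable (Z t) P := fun t => (hZ.hasGaussianLaw_eval t).integrable
    have hmean : ∫ ω, ∑ i, c i * Z (e i) ω ∂P = 0 := by
      rw [integral_finsetSum _ fun i _ => (hi (e i)).const_mul (c i)]
      simp [integral_const_mul, h0]
    have hvar : Var[fun ω => ∑ i, c i * Z (e i) ω; P] = ∑ i, ∑ j, c i * c j * K (e i) (e j) := by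
      rw [variance_of_integral_eq_zero hg.aemeasurable hmean]
      simp_rw [sq, Finset.sum_mul_sum]
      have hm : ∀ i j, Integrable (fun ω => c i * Z (e i) ω * (c j * Z (e j) ω)) P := fun i j =>
        ((hL (e i)).const_mul (c i)).integrable_mul ((hL (e j)).const_mul (c j))
      rw [integral_finsetSum _ fun i _ => integrable_finsetSum _ fun j _ => hm i j]
      refine Finset.sum_congr rfl fun i _ => ?_
      rw [integral_finsetSum _ fun j _ => hm i j]
      refine Finset.sum_congr rfl fun j _ => ?_
      rw [← hK, ← integral_const_mul]
      congr 1; ext ω; ring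
    have h := charFun_gaussianReal (μ := ∫ ω, ∑ i, c i * Z (e i) ω ∂P)
      (v := Var[fun ω => ∑ i, c i * Z (e i) ω; P].toNNReal) 1
    rw [← hg.map_eq_gaussianReal, charFun_apply_real,
      integral_map hg.aemeasurable (by fun_prop), hmean,
      Real.coe_toNNReal _ (variance_nonneg _ _), hvar] at h
    simp only [Complex.ofReal_one, one_mul] at h
    rw [h]
    congr 1
    push_cast; ring

/-- Almost sure limits of centered Gaussian vectors. -/
lemma of_tendsto [IsProbabilityMeasure P] {Z : ℕ → ι → Ω → ℝ} {R : ℕ → Matrix ι ι ℝ}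
    (hZ : ∀ n, IsCenteredGaussianVector P (Z n) (R n))
    (hX : ∀ i, ∀ᵐ ω ∂P, Tendsto (fun n => Z n i ω) atTop (𝓝 (X i ω)))
    (hS : ∀ i j, Tendsto (fun n => R n i j) atTop (𝓝 (S i j))) :
    IsCenteredGaussianVector P X S where
  aemeasurable i := aemeasurable_of_tendsto_metrizable_ae atTop (fun n => (hZ n).aemeasurable i) (hX i)
  symm i j := tendsto_nhds_unique (hS i j) (by simp_rw [fun n => (hZ n).symm i j]; exact hS j i)
  charFun c := by
    have h1 : Tendsto (fun n => ∫ ω, Complex.exp ((∑ i, c i * Z n i ω : ℝ) * I) ∂P) atTop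
        (𝓝 (∫ ω, Complex.exp ((∑ i, c i * X i ω : ℝ) * I) ∂P)) := by
      refine tendsto_integral_of_dominated_convergence (fun _ => 1) (fun n => ?_)
        (integrable_const _) (fun n => ?_) ?_
      · have := (hZ n).aemeasurable_sum c
        have h : AEMeasurable (fun ω => Complex.exp ((∑ i, c i * Z n i ω : ℝ) * I)) P := by
          fun_prop
        exact h.aestronglyMeasurable
      · refine Eventually.of_forall fun ω => ?_
        rw [Complex.norm_exp_ofReal_mul_I]
      · filter_upwards [ae_all_iff.2 hX] with ω hω
        have : Tendsto (fun n => ∑ i, c i * Z n i ω) atTop (𝓝 (∑ i, c i * X i ω)) :=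
          tendsto_finsetSum _ fun i _ => (hω i).const_mul (c i)
        have hc : Continuous fun x : ℝ => Complex.exp ((x : ℂ) * I) := by fun_prop
        exact (hc.tendsto _).comp this
    simp_rw [fun n => (hZ n).charFun c] at h1
    refine tendsto_nhds_unique h1 ?_
    have h2 : Tendsto (fun n => ∑ i, ∑ j, c i * c j * R n i j) atTop
        (𝓝 (∑ i, ∑ j, c i * c j * S i j)) :=
      tendsto_finsetSum _ fun i _ => tendsto_finsetSum _ fun j _ => (hS i j).const_mul _
    have hc : Continuous fun x : ℝ => Complex.exp ((-x / 2 : ℝ)) := by fun_prop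
    exact (hc.tendsto _).comp h2

/-- A sequence all of whose finite-dimensional marginals are centered Gaussian is a Gaussian
process. -/
lemma isGaussianProcess {T : Type*} [IsProbabilityMeasure P] {Z : T → Ω → ℝ} {K : T → T → ℝ}
    (h : ∀ s : Finset T, IsCenteredGaussianVector P (fun i : s => Z i) (fun i j => K i j)) :
    IsGaussianProcess Z P :=
  ⟨fun s => (h s).hasGaussianLaw⟩

end IsCenteredGaussianVector

/-! ### Slepian's inequality by exchanging independent noise for shared noise -/

/-- Chebyshev's association inequality for two bounded antitone functions of one variable. -/
lemma integral_mul_integral_le_of_antitone {μ : Measure ℝ} [IsProbabilityMeasure μ] {φ ψ : ℝ → ℝ}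
    (hφ : Antitone φ) (hψ : Antitone ψ) {B : ℝ} (hφB : ∀ x, |φ x| ≤ B) (hψB : ∀ x, |ψ x| ≤ B) :
    (∫ x, φ x ∂μ) * ∫ x, ψ x ∂μ ≤ ∫ x, φ x * ψ x ∂μ := by
  have iφ : Integrable φ μ := Integrable.of_bound hφ.measurable.aestronglyMeasurable B
    (Eventually.of_forall hφB)
  have iψ : Integrable ψ μ := Integrable.of_bound hψ.measurable.aestronglyMeasurable B
    (Eventually.of_forall hψB)
  have iφψ : Integrable (fun x => φ x * ψ x) μ :=
    iφ.mul_bdd (c := B) hψ.measurable.aestronglyMeasurable (Eventually.of_forall hψB)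
  have h0 : 0 ≤ ∫ z, (φ z.1 - φ z.2) * (ψ z.1 - ψ z.2) ∂(μ.prod μ) := by
    refine integral_nonneg fun z => ?_
    rcases le_total z.1 z.2 with h | h
    · exact mul_nonneg (sub_nonneg.2 (hφ h)) (sub_nonneg.2 (hψ h))
    · exact mul_nonneg_of_nonpos_of_nonpos (sub_nonpos.2 (hφ h)) (sub_nonpos.2 (hψ h))
  have e : ∀ z : ℝ × ℝ, (φ z.1 - φ z.2) * (ψ z.1 - ψ z.2)
      = (φ z.1 * ψ z.1 + φ z.2 * ψ z.2) - (φ z.1 * ψ z.2 + ψ z.1 * φ z.2) := fun z => by ring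
  have i1 : Integrable (fun z : ℝ × ℝ => φ z.1 * ψ z.1) (μ.prod μ) := iφψ.comp_fst μ
  have i2 : Integrable (fun z : ℝ × ℝ => φ z.2 * ψ z.2) (μ.prod μ) := iφψ.comp_snd μ
  have i3 : Integrable (fun z : ℝ × ℝ => φ z.1 * ψ z.2) (μ.prod μ) := iφ.mul_prod iψ
  have i4 : Integrable (fun z : ℝ × ℝ => ψ z.1 * φ z.2) (μ.prod μ) := iψ.mul_prod iφ
  simp_rw [e] at h0
  have i12 : Integrable (fun z : ℝ × ℝ => φ z.1 * ψ z.1 + φ z.2 * ψ z.2) (μ.prod μ) := i1.add i2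
  have i34 : Integrable (fun z : ℝ × ℝ => φ z.1 * ψ z.2 + ψ z.1 * φ z.2) (μ.prod μ) := i3.add i4
  rw [integral_sub i12 i34, integral_add i1 i2, integral_add i3 i4, integral_prod_mul, integral_prod_mul, integral_fun_fst (fun x => φ x * ψ x),
    integral_fun_snd (fun x => φ x * ψ x)] at h0
  simp at h0
  linarith

section Slepian

variable {ι : Type*} [Fintype ι]

/-- The Gaussian integral of `∏ i, f (x i)`. -/
noncomputable def gaussianProdIntegral [DecidableEq ι] (f : ℝ → ℝ) (S : Matrix ι ι ℝ) : ℝ :=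
  ∫ x : EuclideanSpace ℝ ι, ∏ i, f (x i) ∂(multivariateGaussian 0 S)

/-- Continuous antitone functions with values in `[0, 1]`. -/
structure IsAntitoneCutoff (f : ℝ → ℝ) : Prop where
  continuous : Continuous f
  antitone : Antitone f
  nonneg : ∀ x, 0 ≤ f x
  le_one : ∀ x, f x ≤ 1

lemma IsAntitoneCutoff.abs_le_one {f : ℝ → ℝ} (hf : IsAntitoneCutoff f) (x : ℝ) : |f x| ≤ 1 := by
  rw [abs_of_nonneg (hf.nonneg x)]; exact hf.le_one x

lemma IsAntitoneCutoff.abs_prod_le_one {ι : Type*} {f : ℝ → ℝ} (hf : IsAntitoneCutoff f) (s : Finset ι)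
    (x : ι → ℝ) : |∏ i ∈ s, f (x i)| ≤ 1 := by
  rw [Finset.abs_prod]
  exact Finset.prod_le_one (fun i _ => abs_nonneg _) fun i _ => hf.abs_le_one _

lemma IsCenteredGaussianVector.integral_prod_eq [DecidableEq ι] {Ω : Type*} [MeasurableSpace Ω]
    {P : Measure Ω}
    [IsProbabilityMeasure P] {X : ι → Ω → ℝ} {S : Matrix ι ι ℝ}
    (hX : IsCenteredGaussianVector P X S) {f : ℝ → ℝ} (hf : Continuous f) :
    ∫ ω, ∏ i, f (X i ω) ∂P = gaussianProdIntegral f S := by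
  have h := hX.integral_comp_eq (of_posSemidef hX.posSemidef)
    (f := fun x => ∏ i, f (x i)) (by fun_prop)
  exact h

variable [DecidableEq ι]

/-- The vector `e i + e j`. -/
def edgeVector (e : ι × ι) : ι → ℝ := Pi.single e.1 1 + Pi.single e.2 1

lemma isCenteredGaussianVector_edge (e : ι × ι) (a : ℝ) :
    IsCenteredGaussianVector (gaussianReal 0 1) (fun (k : ι) g => a * edgeVector e k * g)
      (a ^ 2 • Matrix.vecMulVec (edgeVector e) (edgeVector e)) := by
  have h1 : IsCenteredGaussianVector (gaussianReal 0 1) (fun (_ : Unit) (g : ℝ) => g)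
      (fun _ _ => 1) := by
    refine ⟨fun _ => by fun_prop, fun _ _ => rfl, fun c => ?_⟩
    have := charFun_gaussianReal (μ := 0) (v := 1) (c ())
    rw [charFun_apply_real] at this
    simp only [Finset.univ_unique, Finset.sum_singleton, Complex.ofReal_mul]
    rw [show (default : Unit) = () from rfl, this]
    congr 1
    push_cast; ring
  have h := h1.linear (fun (k : ι) _ => a * edgeVector e k)
  have e2 : a ^ 2 • Matrix.vecMulVec (edgeVector e) (edgeVector e) = fun k l =>
      ∑ _i : Unit, ∑ _j : Unit, a * edgeVector e k * (a * edgeVector e l) * 1 := by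
    ext k l
    simp [Matrix.vecMulVec_apply]; ring
  rw [e2]
  simpa using h

lemma isCenteredGaussianVector_edge_indep (e : ι × ι) (a : ℝ) :
    IsCenteredGaussianVector ((gaussianReal 0 1).prod (gaussianReal 0 1))
      (fun (k : ι) g => a * (Pi.single (M := fun _ => ℝ) e.1 1 k * g.1 + Pi.single (M := fun _ => ℝ) e.2 1 k * g.2))
      (a ^ 2 • Matrix.diagonal (edgeVector e)) := by
  have h1 : ∀ i : ι, IsCenteredGaussianVector (gaussianReal 0 1)
      (fun (k : ι) (g : ℝ) => Pi.single (M := fun _ => ℝ) i 1 k * g)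
      (Matrix.diagonal (Pi.single i 1)) := fun i => by
    have := isCenteredGaussianVector_edge (i, i) (1 / 2)
    have e1 : ∀ k, edgeVector (i, i) k = 2 * Pi.single (M := fun _ => ℝ) i 1 k := fun k => by
      simp [edgeVector]; ring
    convert this using 1
    · ext k g; rw [e1]; ring
    · ext k l
      rw [Matrix.smul_apply, Matrix.vecMulVec_apply, e1, e1, Matrix.diagonal_apply]
      simp only [Pi.single_apply, smul_eq_mul]
      split_ifs <;> simp_all
      norm_num
  have h := ((h1 e.1).add_prod (h1 e.2)).smul a
  rw [Matrix.diagonal_add] at h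
  exact h

lemma posSemidef_edge (e : ι × ι) :
    (Matrix.vecMulVec (edgeVector e) (edgeVector e)).PosSemidef := by
  simpa using (isCenteredGaussianVector_edge e 1).posSemidef

lemma posSemidef_edge_diagonal (e : ι × ι) : (Matrix.diagonal (edgeVector e)).PosSemidef := by
  simpa using (isCenteredGaussianVector_edge_indep e 1).posSemidef

/-- Both sides add noise of variance `w` to the two endpoints of `e`: independent on the left,
common on the right. For a fixed base vector the integrand is a product of two decreasing functions,
one per endpoint, so Chebyshev's inequality compares the two. -/
lemma gaussianProdIntegral_edge_le {f : ℝ → ℝ} (hf : IsAntitoneCutoff f) {S : Matrix ι ι ℝ}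
    (hS : S.PosSemidef) {e : ι × ι} (he : e.1 ≠ e.2) {w : ℝ} (hw : 0 ≤ w) :
    gaussianProdIntegral f (S + w • Matrix.diagonal (edgeVector e)) ≤
      gaussianProdIntegral f (S + w • Matrix.vecMulVec (edgeVector e) (edgeVector e)) := by
  have hf1 := hf.continuous
  set a := Real.sqrt w with ha
  have haw : w = a ^ 2 := (Real.sq_sqrt hw).symm
  have ha0 : 0 ≤ a := Real.sqrt_nonneg w
  rw [haw]
  have hX := IsCenteredGaussianVector.of_posSemidef hS
  have h1 := hX.add_prod (isCenteredGaussianVector_edge e a)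
  have h2 := hX.add_prod (isCenteredGaussianVector_edge_indep e a)
  have i1 : Integrable (fun z : EuclideanSpace ℝ ι × ℝ => ∏ i, f (z.1 i + a * edgeVector e i * z.2))
      ((multivariateGaussian 0 S).prod (gaussianReal 0 1)) :=
    Integrable.of_bound (by fun_prop) 1 (Eventually.of_forall fun z => hf.abs_prod_le_one _ _)
  have i2 : Integrable (fun z : EuclideanSpace ℝ ι × (ℝ × ℝ) => ∏ i, f (z.1 i + a *
      (Pi.single (M := fun _ => ℝ) e.1 1 i * z.2.1 + Pi.single (M := fun _ => ℝ) e.2 1 i * z.2.2)))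
      ((multivariateGaussian 0 S).prod ((gaussianReal 0 1).prod (gaussianReal 0 1))) :=
    Integrable.of_bound (by fun_prop) 1 (Eventually.of_forall fun z => hf.abs_prod_le_one _ _)
  rw [← h1.integral_prod_eq hf.continuous, ← h2.integral_prod_eq hf.continuous,
    integral_prod _ i1, integral_prod _ i2]
  refine integral_mono i2.integral_prod_left i1.integral_prod_left fun x => ?_
  · dsimp only
    -- The factor of `e.2` is isolated in `ψ`; among the remaining factors only that of `e.1`
    -- depends on the noise.
    let φ : ℝ → ℝ := fun u => ∏ k ∈ Finset.univ.erase e.2,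
      f (x k + a * (Pi.single (M := fun _ => ℝ) e.1 1 k * u))
    let ψ : ℝ → ℝ := fun v => f (x e.2 + a * v)
    have hL : ∀ g : ℝ × ℝ, ∏ k, f (x k + a * (Pi.single (M := fun _ => ℝ) e.1 1 k * g.1
        + Pi.single (M := fun _ => ℝ) e.2 1 k * g.2)) = φ g.1 * ψ g.2 := by
      intro g
      rw [← Finset.prod_erase_mul _ _ (Finset.mem_univ e.2)]
      congr 1
      · refine Finset.prod_congr rfl fun k hk => ?_
        simp [Pi.single_apply, Finset.ne_of_mem_erase hk]
      · simp [ψ, he.symm]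
    have hR : ∀ g : ℝ, ∏ k, f (x k + a * edgeVector e k * g) = φ g * ψ g := by
      intro g
      rw [← hL (g, g)]
      refine Finset.prod_congr rfl fun k _ => ?_
      simp only [edgeVector, Pi.add_apply]
      congr 2; ring
    simp_rw [hL, hR]
    rw [integral_prod_mul]
    refine integral_mul_integral_le_of_antitone (B := 1) ?_ ?_ (fun u => hf.abs_prod_le_one _ _)
      fun v => hf.abs_le_one _
    · intro u v huv
      refine Finset.prod_le_prod (fun k _ => hf.nonneg _) fun k _ => hf.antitone ?_
      have : (0 : ℝ) ≤ Pi.single (M := fun _ => ℝ) e.1 1 k := by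
        rw [Pi.single_apply]; split_ifs <;> simp
      gcongr
    · intro u v huv
      exact hf.antitone (by gcongr)

/-- Edges are exchanged one at a time, the noise of all other edges being absorbed into the base
covariance. Loops must have weight zero, since sharing noise with itself would change the variance.
-/
lemma gaussianProdIntegral_edges_le {f : ℝ → ℝ} (hf : IsAntitoneCutoff f) {w : ι × ι → ℝ}
    (hw : ∀ e, 0 ≤ w e) (hw0 : ∀ e, e.1 = e.2 → w e = 0) (F : Finset (ι × ι)) :
    ∀ {S : Matrix ι ι ℝ}, S.PosSemidef →
    gaussianProdIntegral f (S + ∑ e ∈ F, w e • Matrix.diagonal (edgeVector e)) ≤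
      gaussianProdIntegral f
        (S + ∑ e ∈ F, w e • Matrix.vecMulVec (edgeVector e) (edgeVector e)) := by
  induction F using Finset.induction_on with
  | empty => intro S hS; simp
  | insert e F heF ih =>
    intro S hS
    rw [Finset.sum_insert heF, Finset.sum_insert heF, ← add_assoc]
    refine (ih (hS.add ((posSemidef_edge_diagonal e).smul (hw e)))).trans ?_
    by_cases he : e.1 = e.2
    · simp [hw0 e he]
    · have hS' : (S + ∑ e ∈ F, w e • Matrix.vecMulVec (edgeVector e) (edgeVector e)).PosSemidef :=
        hS.add (Matrix.posSemidef_sum _ fun e _ => (posSemidef_edge e).smul (hw e))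
      have := gaussianProdIntegral_edge_le hf hS' he (hw e)
      rw [add_right_comm]
      refine this.trans (le_of_eq ?_)
      rw [add_assoc, add_comm (∑ e ∈ F, _)]

/-- Sharing the noise of an edge adds exactly its two symmetric off-diagonal entries. Every
unordered pair is met twice among the ordered pairs, hence the factor 1/2. -/
lemma sum_edges_eq {C : Matrix ι ι ℝ} (hC : ∀ i j, C i j = C j i) (hC0 : ∀ i, C i i = 0) :
    ∑ e : ι × ι, (C e.1 e.2 / 2) • Matrix.vecMulVec (edgeVector e) (edgeVector e) =
      (∑ e : ι × ι, (C e.1 e.2 / 2) • Matrix.diagonal (edgeVector e)) + C := by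
  have key : ∀ e : ι × ι, (C e.1 e.2 / 2) • Matrix.vecMulVec (edgeVector e) (edgeVector e) =
      (C e.1 e.2 / 2) • Matrix.diagonal (edgeVector e) +
      (C e.1 e.2 / 2) • (Matrix.single e.1 e.2 1 + Matrix.single e.2 e.1 1) := by
    intro e
    by_cases he : e.1 = e.2
    · rw [he, hC0]; simp
    · rw [← smul_add]
      congr 1
      ext k l
      simp only [Matrix.vecMulVec_apply, edgeVector, Pi.add_apply, Pi.single_apply,
        Matrix.add_apply, Matrix.diagonal_apply, Matrix.single_apply]
      by_cases h1 : k = e.1 <;> by_cases h2 : k = e.2 <;> by_cases h3 : l = e.1 <;>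
        by_cases h4 : l = e.2 <;> simp_all [eq_comm]
  simp_rw [key, Finset.sum_add_distrib]
  congr 1
  ext k l
  simp only [Matrix.sum_apply, Matrix.smul_apply, Matrix.add_apply, Matrix.single_apply,
    smul_eq_mul, mul_add, Finset.sum_add_distrib, Fintype.sum_prod_type, ite_and, mul_ite, mul_one,
    mul_zero]
  simp [hC l k]

lemma tendsto_gaussianProdIntegral {f : ℝ → ℝ} (hf : IsAntitoneCutoff f) {S K : Matrix ι ι ℝ}
    (hS : S.PosSemidef) (hK : K.PosSemidef) :
    Tendsto (fun n : ℕ => gaussianProdIntegral f (S + (1 / ((n : ℝ) + 1)) • K)) atTop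
      (𝓝 (gaussianProdIntegral f S)) := by
  have hX := IsCenteredGaussianVector.of_posSemidef hS
  have hW := IsCenteredGaussianVector.of_posSemidef hK
  have hf1 := hf.continuous
  have h1 : ∀ n : ℕ, gaussianProdIntegral f (S + (1 / ((n : ℝ) + 1)) • K) =
      ∫ z : EuclideanSpace ℝ ι × EuclideanSpace ℝ ι,
        ∏ i, f (z.1 i + Real.sqrt (1 / ((n : ℝ) + 1)) * z.2 i)
        ∂((multivariateGaussian 0 S).prod (multivariateGaussian 0 K)) := by
    intro n
    have := (hX.add_prod (hW.smul (Real.sqrt (1 / ((n : ℝ) + 1))))).integral_prod_eq hf.continuous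
    rw [Real.sq_sqrt (by positivity)] at this
    exact this.symm
  have h2 : gaussianProdIntegral f S =
      ∫ z : EuclideanSpace ℝ ι × EuclideanSpace ℝ ι, ∏ i, f (z.1 i)
        ∂((multivariateGaussian 0 S).prod (multivariateGaussian 0 K)) := by
    rw [integral_fun_fst (fun x : EuclideanSpace ℝ ι => ∏ i, f (x i))]
    simp [gaussianProdIntegral]
  simp_rw [h1]
  rw [h2]
  refine tendsto_integral_of_dominated_convergence (fun _ => 1) (fun n => ?_)
    (integrable_const _) (fun n => Eventually.of_forall fun z => hf.abs_prod_le_one _ _)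
    (Eventually.of_forall fun z => ?_)
  · fun_prop
  · refine tendsto_finsetProd _ fun i _ => ?_
    refine (hf.continuous.tendsto _).comp ?_
    have : Tendsto (fun n : ℕ => Real.sqrt (1 / ((n : ℝ) + 1))) atTop (𝓝 (Real.sqrt 0)) :=
      (Real.continuous_sqrt.tendsto _).comp tendsto_one_div_add_atTop_nhds_zero_nat
    rw [Real.sqrt_zero] at this
    simpa using (this.mul_const (z.2 i)).const_add (z.1 i)

/-- Slepian's inequality for products of antitone cutoffs. -/
lemma gaussianProdIntegral_mono {f : ℝ → ℝ} (hf : IsAntitoneCutoff f) {S T : Matrix ι ι ℝ}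
    (hS : S.PosSemidef) (hT : T.PosSemidef) (hdiag : ∀ i, S i i = T i i)
    (hle : ∀ i j, S i j ≤ T i j) : gaussianProdIntegral f S ≤ gaussianProdIntegral f T := by
  set C := T - S with hCdef
  have hC : ∀ i j, C i j = C j i := fun i j => by
    have h1 := hS.1.apply i j
    have h2 := hT.1.apply i j
    simp only [star_trivial] at h1 h2
    simp [hCdef, h1, h2]
  have hC0 : ∀ i, C i i = 0 := fun i => by simp [hCdef, hdiag]
  have hCn : ∀ i j, 0 ≤ C i j := fun i j => by simp [hCdef, hle]
  set K := ∑ e : ι × ι, (C e.1 e.2 / 2) • Matrix.diagonal (edgeVector e) with hKdef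
  have hK : K.PosSemidef := Matrix.posSemidef_sum _ fun e _ =>
    (posSemidef_edge_diagonal e).smul (by have := hCn e.1 e.2; positivity)
  -- The segment from `S` to `T` is walked in `n + 1` steps of length `d`, with an auxiliary
  -- diagonal noise `d • K` that disappears as `n` grows.
  have key : ∀ n : ℕ, gaussianProdIntegral f (S + (1 / ((n : ℝ) + 1)) • K) ≤
      gaussianProdIntegral f (T + (1 / ((n : ℝ) + 1)) • K) := by
    intro n
    set d : ℝ := 1 / ((n : ℝ) + 1) with hd
    have hd0 : 0 ≤ d := by positivity
    have step : ∀ k : ℕ, k ≤ n + 1 → gaussianProdIntegral f (S + d • K) ≤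
        gaussianProdIntegral f (S + ((k : ℝ) * d) • C + d • K) := by
      intro k
      induction k with
      | zero => intro _; simp
      | succ k ih =>
        intro hk
        refine (ih (by omega)).trans ?_
        have hkd : (k : ℝ) * d ≤ 1 := by
          rw [hd, mul_one_div, div_le_one (by positivity)]
          exact_mod_cast (by omega : k ≤ n + 1)
        have hSk : (S + ((k : ℝ) * d) • C).PosSemidef := by
          have e : S + ((k : ℝ) * d) • C = (1 - (k : ℝ) * d) • S + ((k : ℝ) * d) • T := by
            rw [hCdef, smul_sub, sub_smul, one_smul]; abel
          rw [e]
          exact (hS.smul (sub_nonneg.2 hkd)).add (hT.smul (by positivity))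
        -- Exchanging turns `d • K` into `d • (K + C)`: the covariance advances by `d • C` and the
        -- same `d • K` remains for the next step, so noise does not accumulate.
        have h := gaussianProdIntegral_edges_le hf (w := fun e => d * (C e.1 e.2 / 2))
          (fun e => by have := hCn e.1 e.2; positivity) (fun e he => by simp [he, hC0])
          Finset.univ hSk
        simp_rw [mul_smul, ← Finset.smul_sum] at h
        rw [sum_edges_eq hC hC0, ← hKdef] at h
        have e : S + ((k : ℝ) * d) • C + d • (K + C) =
            S + (((k + 1 : ℕ) : ℝ) * d) • C + d • K := by
          rw [smul_add]; push_cast; rw [add_mul, add_smul, one_mul]; abel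
        rw [← e]
        simpa only [mul_smul] using h
    have := step (n + 1) le_rfl
    have e1 : ((n + 1 : ℕ) : ℝ) * d = 1 := by rw [hd]; push_cast; field_simp
    rw [e1, one_smul, hCdef, add_sub_cancel] at this
    exact this
  exact le_of_tendsto_of_tendsto' (tendsto_gaussianProdIntegral hf hS hK)
    (tendsto_gaussianProdIntegral hf hT hK) key

/-- A continuous antitone approximation of the indicator function of the negative half-line. -/
noncomputable def negCutoff (n : ℕ) (x : ℝ) : ℝ := min 1 (max 0 (-(n * x)))

lemma isAntitoneCutoff_negCutoff (n : ℕ) : IsAntitoneCutoff (negCutoff n) where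
  continuous := by unfold negCutoff; fun_prop
  antitone x y hxy := by unfold negCutoff; gcongr
  nonneg x := by unfold negCutoff; positivity
  le_one x := min_le_left _ _

lemma tendsto_negCutoff (x : ℝ) :
    Tendsto (fun n => negCutoff n x) atTop (𝓝 (if x < 0 then 1 else 0)) := by
  split_ifs with hx
  · obtain ⟨N, hN⟩ := exists_nat_ge (1 / (-x))
    refine tendsto_const_nhds.congr' ?_
    filter_upwards [eventually_ge_atTop N] with n hn
    have hx' : 0 < -x := by linarith
    have h1 : (1 : ℝ) ≤ -(n * x) := by
      have : (1 / (-x)) ≤ (n : ℝ) := hN.trans (by exact_mod_cast hn)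
      rw [div_le_iff₀ hx'] at this
      linarith
    rw [negCutoff, max_eq_right (by linarith), min_eq_left h1]
  · refine tendsto_const_nhds.congr fun n => ?_
    have : 0 ≤ (n : ℝ) * x := mul_nonneg (by positivity) (not_lt.1 hx)
    rw [negCutoff, max_eq_left (by linarith), min_eq_right zero_le_one]

omit [DecidableEq ι] in
lemma IsCenteredGaussianVector.measureReal_neg_eq_integral {Ω : Type*}
    [MeasurableSpace Ω] {P : Measure Ω} [IsProbabilityMeasure P] {X : ι → Ω → ℝ} {S : Matrix ι ι ℝ}
    (hX : IsCenteredGaussianVector P X S) :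
    P.real {ω | ∀ i, X i ω < 0} = ∫ ω, ∏ i, (if X i ω < 0 then (1 : ℝ) else 0) ∂P := by
  have hm : NullMeasurableSet {ω | ∀ i, X i ω < 0} P := by
    rw [Set.ofPred_forall]
    exact NullMeasurableSet.iInter fun i =>
      nullMeasurableSet_lt (hX.aemeasurable i) aemeasurable_const
  have h2 : ∫ ω, Set.indicator {ω | ∀ i, X i ω < 0} (fun _ => (1 : ℝ)) ω ∂P =
      P.real {ω | ∀ i, X i ω < 0} := by
    rw [integral_indicator₀ hm]; simp
  rw [← h2]
  congr 1
  ext ω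
  rw [Finset.prod_ite_zero]
  simp [Set.indicator_apply]

lemma IsCenteredGaussianVector.tendsto_gaussianProdIntegral_negCutoff {Ω : Type*}
    [MeasurableSpace Ω] {P : Measure Ω} [IsProbabilityMeasure P] {X : ι → Ω → ℝ} {S : Matrix ι ι ℝ}
    (hX : IsCenteredGaussianVector P X S) :
    Tendsto (fun n => gaussianProdIntegral (negCutoff n) S) atTop
      (𝓝 (P.real {ω | ∀ i, X i ω < 0})) := by
  rw [hX.measureReal_neg_eq_integral]
  simp_rw [fun n => (hX.integral_prod_eq (isAntitoneCutoff_negCutoff n).continuous).symm]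
  refine tendsto_integral_of_dominated_convergence (fun _ => 1) (fun n => ?_)
    (integrable_const _)
    (fun n => Eventually.of_forall fun z => (isAntitoneCutoff_negCutoff n).abs_prod_le_one _ _)
    (Eventually.of_forall fun z => tendsto_finsetProd _ fun i _ => tendsto_negCutoff _)
  refine (Finset.aemeasurable_fun_prod _ fun i _ => ?_).aestronglyMeasurable
  exact (isAntitoneCutoff_negCutoff n).continuous.measurable.comp_aemeasurable (hX.aemeasurable i)

end Slepian

/-! ### Slepian's inequality and association for orthant probabilities -/

section SlepianConsequences

variable {ι κ Ω Ω' : Type*} [Fintype ι] [Fintype κ] [MeasurableSpace Ω] [MeasurableSpace Ω']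
  {P : Measure Ω} {P' : Measure Ω'} [IsProbabilityMeasure P] [IsProbabilityMeasure P']

/-- Slepian's inequality. -/
theorem IsCenteredGaussianVector.slepian {X : ι → Ω → ℝ} {X' : ι → Ω' → ℝ} {S T : Matrix ι ι ℝ}
    (hX : IsCenteredGaussianVector P X S) (hX' : IsCenteredGaussianVector P' X' T)
    (hdiag : ∀ i, S i i = T i i) (hle : ∀ i j, S i j ≤ T i j) :
    P.real {ω | ∀ i, X i ω < 0} ≤ P'.real {ω | ∀ i, X' i ω < 0} := by
  classical
  exact le_of_tendsto_of_tendsto' hX.tendsto_gaussianProdIntegral_negCutoff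
    hX'.tendsto_gaussianProdIntegral_negCutoff fun n => gaussianProdIntegral_mono
      (isAntitoneCutoff_negCutoff n) hX.posSemidef hX'.posSemidef hdiag hle

lemma IsCenteredGaussianVector.measureReal_neg_eq {X : ι → Ω → ℝ} {X' : ι → Ω' → ℝ}
    {S : Matrix ι ι ℝ}
    (hX : IsCenteredGaussianVector P X S) (hX' : IsCenteredGaussianVector P' X' S) :
    P.real {ω | ∀ i, X i ω < 0} = P'.real {ω | ∀ i, X' i ω < 0} :=
  le_antisymm (hX.slepian hX' (fun _ => rfl) fun _ _ => le_rfl)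
    (hX'.slepian hX (fun _ => rfl) fun _ _ => le_rfl)

/-- Positive association of the negative orthant probabilities of two Gaussian vectors with
non-negative cross-covariances. -/
theorem IsCenteredGaussianVector.mul_le_measureReal_neg {X : ι ⊕ κ → Ω → ℝ}
    {S : Matrix (ι ⊕ κ) (ι ⊕ κ) ℝ} (hX : IsCenteredGaussianVector P X S)
    (hS : ∀ i k, 0 ≤ S (Sum.inl i) (Sum.inr k)) :
    P.real {ω | ∀ i, X (Sum.inl i) ω < 0} * P.real {ω | ∀ k, X (Sum.inr k) ω < 0} ≤
      P.real {ω | ∀ i, X i ω < 0} := by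
  have h := ((hX.reindex Sum.inl).prod (hX.reindex Sum.inr)).slepian hX
    (by rintro (i | k) <;> rfl) (by
      rintro (i | k) (j | l)
      · exact le_rfl
      · exact hS i l
      · change (0 : ℝ) ≤ _
        rw [hX.symm]; exact hS j k
      · exact le_rfl)
  refine le_trans (le_of_eq ?_) h
  rw [← measureReal_prod_prod]
  congr 1
  ext z
  simp

end SlepianConsequences

/-! ### Exponential decay under diagonal dominance -/

lemma gaussianReal_real_Iio_lt_one (x : ℝ) : (gaussianReal 0 1).real (Set.Iio x) < 1 := by
  have h1 : (gaussianReal 0 1) (Set.Ici x) ≠ 0 := fun h => by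
    have := gaussianReal_absolutelyContinuous' 0 one_ne_zero h
    simp at this
  have h2 : (gaussianReal 0 1).real (Set.Iio x) = 1 - (gaussianReal 0 1).real (Set.Ici x) := by
    rw [← Set.compl_Ici, probReal_compl_eq_one_sub measurableSet_Ici]
  have h3 : 0 < (gaussianReal 0 1).real (Set.Ici x) :=
    ENNReal.toReal_pos h1 (measure_ne_top _ _)
  linarith

lemma gaussianReal_real_Iio_pos (x : ℝ) : 0 < (gaussianReal 0 1).real (Set.Iio x) := by
  refine ENNReal.toReal_pos (fun h => ?_) (measure_ne_top _ _)
  have := gaussianReal_absolutelyContinuous' 0 one_ne_zero h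
  simp at this

lemma gaussianReal_real_Iio_neg_le (b : ℝ) :
    (gaussianReal 0 1).real (Set.Iio (-b)) ≤ Real.exp (1 / 2 - b) := by
  have h := measure_le_le_exp_mul_mgf (μ := gaussianReal 0 1) (X := id) (t := -1) (-b)
    (by norm_num) (integrable_exp_mul_gaussianReal _)
  rw [mgf_id_gaussianReal, ← Real.exp_add] at h
  refine (measureReal_mono (fun x (hx : x < -b) => hx.le)).trans (h.trans (le_of_eq ?_))
  congr 1
  simp; ring

/-- An exponential bound of the Gaussian distribution function, with a constant less than `1`. -/
lemma exists_gaussianReal_real_Iio_neg_le : ∃ c : ℝ, 0 < c ∧ c < 1 ∧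
    ∀ b : ℝ, (gaussianReal 0 1).real (Set.Iio (-b)) ≤ Real.exp (-c * (1 + b)) := by
  set q := (gaussianReal 0 1).real (Set.Iio (1 : ℝ)) with hq
  have hq0 : 0 < q := gaussianReal_real_Iio_pos 1
  have hq1 : q < 1 := gaussianReal_real_Iio_lt_one 1
  have hlq : 0 < -Real.log q := by have := Real.log_neg hq0 hq1; linarith
  -- For `b ≤ -1` the bound is at least 1. For `-1 ≤ b ≤ 1` the probability is at most `q`, and `q ≤
  -- exp (-2c)` by the second entry of the minimum. For `b ≥ 1` the Chernoff bound `exp (1/2 - b)`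
  -- suffices once `c ≤ 1/4`; 1/9 is merely convenient.
  refine ⟨min (1 / 9) (-Real.log q / 2), by positivity, (min_le_left _ _).trans_lt (by norm_num),
    fun b => ?_⟩
  set c := min (1 / 9) (-Real.log q / 2) with hc
  have hc0 : 0 < c := by positivity
  have hc1 : c ≤ 1 / 9 := min_le_left _ _
  have hc2 : c ≤ -Real.log q / 2 := min_le_right _ _
  rcases le_total b (-1) with h1 | h1
  · refine measureReal_le_one.trans (Real.one_le_exp ?_)
    nlinarith
  rcases le_total b 1 with h2 | h2
  · calc (gaussianReal 0 1).real (Set.Iio (-b)) ≤ q :=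
          measureReal_mono (Set.Iio_subset_Iio (by linarith))
      _ = Real.exp (Real.log q) := (Real.exp_log hq0).symm
      _ ≤ _ := Real.exp_le_exp.2 (by nlinarith)
  · exact (gaussianReal_real_Iio_neg_le b).trans (Real.exp_le_exp.2 (by nlinarith))

lemma isCenteredGaussianVector_pi {ι : Type*} [Fintype ι] [DecidableEq ι] :
    IsCenteredGaussianVector (Measure.pi fun _ : ι => gaussianReal 0 1) (fun i x => x i) 1 where
  aemeasurable i := (measurable_pi_apply i).aemeasurable
  symm i j := by simp [Matrix.one_apply, eq_comm]
  charFun c := by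
    simp_rw [Complex.ofReal_sum, Finset.sum_mul, Complex.exp_sum]
    rw [integral_fintype_prod_eq_prod (fun i (x : ℝ) => Complex.exp (((c i * x : ℝ) : ℂ) * Complex.I))]
    have h : ∀ i, ∫ x, Complex.exp (((c i * x : ℝ) : ℂ) * Complex.I) ∂(gaussianReal 0 1) =
        Complex.exp ((-(c i) ^ 2 / 2 : ℝ)) := fun i => by
      have := charFun_gaussianReal (μ := 0) (v := 1) (c i)
      rw [charFun_apply_real] at this
      simp only [Complex.ofReal_mul]
      rw [this]
      congr 1
      push_cast; ring
    simp_rw [h]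
    rw [← Complex.exp_sum, ← Complex.ofReal_sum]
    congr 2
    simp [Matrix.one_apply, sq, Finset.sum_neg_distrib, ← Finset.sum_div]

lemma IsCenteredGaussianVector.integral_exp {ι Ω : Type*} [Fintype ι] [MeasurableSpace Ω]
    {P : Measure Ω} [IsProbabilityMeasure P] {X : ι → Ω → ℝ} {S : Matrix ι ι ℝ}
    (hX : IsCenteredGaussianVector P X S) (c : ι → ℝ) :
    Integrable (fun ω => Real.exp (∑ i, c i * X i ω)) P ∧
    ∫ ω, Real.exp (∑ i, c i * X i ω) ∂P = Real.exp ((∑ i, ∑ j, c i * c j * S i j) / 2) := by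
  obtain ⟨h0, h⟩ := hX.map_sum_eq_gaussianReal c
  have hi := integrable_exp_mul_gaussianReal (μ := 0)
    (v := (∑ i, ∑ j, c i * c j * S i j).toNNReal) 1
  have h1 := mgf_gaussianReal h 1
  rw [← h, integrable_map_measure (by fun_prop) (hX.aemeasurable_sum c)] at hi
  simp only [one_mul, Function.comp_def] at hi
  refine ⟨hi, ?_⟩
  simp only [mgf, one_mul] at h1
  rw [h1, Real.coe_toNNReal _ h0]
  simp

/-- A Gaussian vector whose covariance matrix is non-negative and sufficiently diagonally
dominant has an exponentially small probability of being negative. -/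
lemma exists_measureReal_neg_le_pow : ∃ q : ℝ, 0 < q ∧ q < 1 ∧
    ∀ {ι Ω : Type*} [Fintype ι] [DecidableEq ι] [MeasurableSpace Ω] (P : Measure Ω)
      [IsProbabilityMeasure P]
      (X : ι → Ω → ℝ) (S : Matrix ι ι ℝ), IsCenteredGaussianVector P X S → (∀ i, S i i = 1) →
      (∀ i j, 0 ≤ S i j) → (∀ i, ∑ j, S i j ≤ 3 / 2) →
      P.real {ω | ∀ i, X i ω < 0} ≤ q ^ Fintype.card ι := by
  obtain ⟨c, hc0, hc1, hc⟩ := exists_gaussianReal_real_Iio_neg_le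
  refine ⟨Real.exp (-c + c ^ 2), Real.exp_pos _, Real.exp_lt_one_iff.2 (by nlinarith), ?_⟩
  intro ι Ω _ _ _ P _ X S hX hd hn hrow
  set C : Matrix ι ι ℝ := S - (1 / 2 : ℝ) • (1 : Matrix ι ι ℝ) with hCdef
  have hCpsd : C.PosSemidef := by
    refine Matrix.PosSemidef.of_dotProduct_mulVec_nonneg ?_ fun x => ?_
    · ext i j
      simp [hCdef, Matrix.one_apply, hX.symm i j, eq_comm]
    · have h1 : star x ⬝ᵥ C.mulVec x = ∑ i, ∑ j, S i j * (x i * x j) - ∑ i, x i ^ 2 / 2 := by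
        simp only [hCdef, Matrix.sub_mulVec, dotProduct_sub, Matrix.smul_mulVec, Matrix.one_mulVec,
          dotProduct_smul, star_trivial, smul_eq_mul]
        simp only [dotProduct, Matrix.mulVec, Finset.mul_sum, ← Finset.sum_sub_distrib]
        refine Finset.sum_congr rfl fun i _ => ?_
        congr 1
        · exact Finset.sum_congr rfl fun j _ => by ring
        · ring
      rw [h1]
      -- Expanding these off-diagonal squares and using row sums at most 3/2 gives xᵀSx ≥ |x|²/2,
      -- that is, `C` is positive semidefinite.
      have h2 : 0 ≤ ∑ i, ∑ j, (if i = j then 0 else S i j * (x i + x j) ^ 2) :=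
        Finset.sum_nonneg fun i _ => Finset.sum_nonneg fun j _ => by
          split_ifs
          · exact le_rfl
          · exact mul_nonneg (hn i j) (sq_nonneg _)
      have h3 : ∑ i, ∑ j, (if i = j then 0 else S i j * (x i + x j) ^ 2) =
          ∑ i, ∑ j, S i j * (x i + x j) ^ 2 - ∑ i, 4 * x i ^ 2 := by
        rw [← Finset.sum_sub_distrib]
        refine Finset.sum_congr rfl fun i _ => ?_
        have : ∀ j, (if i = j then 0 else S i j * (x i + x j) ^ 2) =
            S i j * (x i + x j) ^ 2 - (if i = j then 4 * x i ^ 2 else 0) := fun j => by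
          split_ifs with h
          · subst h; rw [hd]; ring
          · ring
        simp_rw [this, Finset.sum_sub_distrib]
        simp
      have h4 : ∑ i, ∑ j, S i j * (x i + x j) ^ 2 =
          2 * (∑ i, x i ^ 2 * ∑ j, S i j) + 2 * ∑ i, ∑ j, S i j * (x i * x j) := by
        have e1 : ∑ i, ∑ j, S i j * x j ^ 2 = ∑ i, x i ^ 2 * ∑ j, S i j := by
          rw [Finset.sum_comm]
          refine Finset.sum_congr rfl fun i _ => ?_
          rw [Finset.mul_sum]
          exact Finset.sum_congr rfl fun j _ => by rw [hX.symm]; ring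
        have e2 : ∑ i, ∑ j, S i j * x i ^ 2 = ∑ i, x i ^ 2 * ∑ j, S i j := by
          refine Finset.sum_congr rfl fun i _ => ?_
          rw [Finset.mul_sum]
          exact Finset.sum_congr rfl fun j _ => by ring
        rw [two_mul]
        nth_rw 1 [← e1]
        rw [← e2]
        simp_rw [Finset.mul_sum, ← Finset.sum_add_distrib]
        exact Finset.sum_congr rfl fun i _ => Finset.sum_congr rfl fun j _ => by ring
      have h5 : ∑ i, x i ^ 2 * ∑ j, S i j ≤ ∑ i, 3 * (x i ^ 2 / 2) :=
        Finset.sum_le_sum fun i _ => by nlinarith [hrow i, sq_nonneg (x i)]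
      rw [← Finset.mul_sum] at h5
      have h6 : ∑ i, 4 * x i ^ 2 = 8 * ∑ i, x i ^ 2 / 2 := by
        rw [Finset.mul_sum]; exact Finset.sum_congr rfl fun i _ => by ring
      linarith
  have hB := IsCenteredGaussianVector.of_posSemidef hCpsd
  set a : ℝ := Real.sqrt (1 / 2) with ha
  have ha0 : 0 < a := by positivity
  have ha2 : a ^ 2 = 1 / 2 := Real.sq_sqrt (by norm_num)
  -- `X` has the law of B + a g with B of covariance `C` and g an independent white noise. Given B,
  -- the coordinates are independent and the one-dimensional bound applies to each.
  have hsum := hB.add_prod ((isCenteredGaussianVector_pi (ι := ι)).smul a)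
  rw [ha2, hCdef, sub_add_cancel, ← hCdef] at hsum
  rw [hX.measureReal_neg_eq hsum, hsum.measureReal_neg_eq_integral, integral_prod]
  swap
  · refine Integrable.of_bound (C := 1) ?_ (Eventually.of_forall fun z => ?_)
    · refine Measurable.aestronglyMeasurable ?_
      refine Finset.measurable_fun_prod _ fun i _ => ?_
      exact Measurable.ite (measurableSet_lt (by fun_prop) measurable_const) measurable_const
        measurable_const
    · rw [Real.norm_eq_abs, Finset.abs_prod]
      exact Finset.prod_le_one (fun i _ => abs_nonneg _) fun i _ => by split_ifs <;> simp
  have hinner : ∀ x : EuclideanSpace ℝ ι, ∫ g : ι → ℝ, ∏ i, (if x i + a * g i < 0 then (1 : ℝ) else 0)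
      ∂(Measure.pi fun _ : ι => gaussianReal 0 1) ≤
      Real.exp (-c) ^ Fintype.card ι * Real.exp (∑ i, (-c / a) * x i) := by
    intro x
    rw [integral_fintype_prod_eq_prod (fun i (g : ℝ) => (if x i + a * g < 0 then (1 : ℝ) else 0)),
      Real.exp_sum, ← Finset.card_univ, ← Finset.prod_const, ← Finset.prod_mul_distrib]
    refine Finset.prod_le_prod (fun i _ => integral_nonneg fun g => by split_ifs <;> simp)
      fun i _ => ?_
    have e : ∫ g, (if x i + a * g < 0 then (1 : ℝ) else 0) ∂(gaussianReal 0 1) =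
        (gaussianReal 0 1).real (Set.Iio (-(x i / a))) := by
      rw [← integral_indicator_one measurableSet_Iio]
      congr 1
      ext g
      simp only [Set.indicator_apply, Set.mem_Iio, Pi.one_apply]
      congr 1
      rw [← neg_div, lt_div_iff₀ ha0, eq_iff_iff]
      constructor <;> intro h <;> linarith
    rw [e, ← Real.exp_add]
    refine (hc _).trans (le_of_eq ?_)
    congr 1
    field_simp; ring
  -- Averaging over B costs `exp (c² ∑ C i j)`, because `a² = 1/2`. The row sums of `C` are at most
  -- 1, so the total exponent is at most (-c + c²) per coordinate, negative since c < 1.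
  obtain ⟨hint, hexp⟩ := hB.integral_exp (fun _ => -c / a)
  refine (integral_mono_of_nonneg (Eventually.of_forall fun x => integral_nonneg fun g =>
    Finset.prod_nonneg fun i _ => by split_ifs <;> simp) (hint.const_mul _)
    (Eventually.of_forall hinner)).trans ?_
  rw [integral_const_mul, hexp, Real.exp_add, mul_pow, ← Real.exp_nat_mul (c ^ 2)]
  gcongr
  have e1 : (-c / a) * (-c / a) = 2 * c ^ 2 := by
    rw [div_mul_div_comm, ← sq a, ha2]; ring
  have e2 : ∑ i, ∑ j, C i j ≤ Fintype.card ι := by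
    have : ∀ i, ∑ j, C i j ≤ 1 := fun i => by
      have := hrow i
      simp only [hCdef, Matrix.sub_apply, Matrix.smul_apply, Matrix.one_apply,
        Finset.sum_sub_distrib]
      simp
      linarith
    calc ∑ i, ∑ j, C i j ≤ ∑ i : ι, (1 : ℝ) := Finset.sum_le_sum fun i _ => this i
      _ = _ := by simp
  simp_rw [e1, ← Finset.mul_sum]
  nlinarith [sq_nonneg c]

/-! ### Persistence exponents of stationary Gaussian sequences -/

lemma persistenceProb_eq_fin {Ω : Type*} [MeasurableSpace Ω] (P : Measure Ω) (Z : ℕ → Ω → ℝ)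
    (n : ℕ) : persistenceProb P Z n = P.real {ω | ∀ i : Fin n, Z (i + 1) ω < 0} := by
  unfold persistenceProb
  congr 1
  ext ω
  simp only [Finset.mem_Icc, Set.mem_ofPred_eq]
  constructor
  · intro h i
    exact h _ ⟨by omega, by omega⟩
  · intro h l hl
    have := h ⟨l - 1, by omega⟩
    simpa [Nat.sub_add_cancel hl.1] using this

namespace IsStationaryGaussianSeq

variable {Ω : Type*} [MeasurableSpace Ω] {P : Measure Ω} [IsProbabilityMeasure P]
  {Z : ℕ → Ω → ℝ} {A : ℤ → ℝ}

lemma vector {ι : Type*} [Fintype ι] (hZ : IsStationaryGaussianSeq P Z A) (e : ι → ℕ) :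
    IsCenteredGaussianVector P (fun i => Z (e i)) (fun i j => A ((e i : ℤ) - e j)) :=
  IsCenteredGaussianVector.of_isGaussianProcess hZ.gaussian hZ.centered
    (K := fun s t => A ((s : ℤ) - t)) hZ.covariance e

omit [IsProbabilityMeasure P] in
lemma even (hZ : IsStationaryGaussianSeq P Z A) (k : ℤ) : A (-k) = A k := by
  have h : ∀ n : ℕ, A (-n) = A n := fun n => by
    have h1 := hZ.covariance 0 n
    have h2 := hZ.covariance n 0
    simp only [Nat.cast_zero, zero_sub, sub_zero] at h1 h2
    rw [← h1, ← h2]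
    simp_rw [mul_comm]
  rcases Int.eq_nat_or_neg k with ⟨n, rfl | rfl⟩
  · exact h n
  · rw [neg_neg, h n]

/-- The correlation function of a sequence on an arbitrary space is one in the sense of
`IsCorrelationFunction`. -/
lemma isCorrelationFunction (hZ : IsStationaryGaussianSeq P Z A) : IsCorrelationFunction A := by
  have hm : AEMeasurable (fun ω n => Z n ω) P := aemeasurable_pi_iff.2 hZ.gaussian.aemeasurable
  -- The coordinate process on `ℕ → ℝ` is used because `IsCorrelationFunction` asks for a space in
  -- the lowest universe.
  refine ⟨ℕ → ℝ, inferInstance, P.map (fun ω n => Z n ω), Measure.isProbabilityMeasure_map hm,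
    fun n x => x n, ⟨⟨fun I => ⟨?_⟩⟩, fun i => ?_, hZ.unit_variance, fun i j => ?_⟩⟩
  · rw [AEMeasurable.map_map_of_aemeasurable (Measurable.aemeasurable (by fun_prop)) hm]
    exact (hZ.gaussian.hasGaussianLaw I).isGaussian_map
  · rw [integral_map hm (Measurable.aestronglyMeasurable (by fun_prop))]
    exact hZ.centered i
  · rw [integral_map hm (Measurable.aestronglyMeasurable (by fun_prop))]
    exact hZ.covariance i j

lemma persistenceProb_congr {Ω' : Type*} [MeasurableSpace Ω'] {P' : Measure Ω'}
    [IsProbabilityMeasure P'] {Z' : ℕ → Ω' → ℝ} (hZ : IsStationaryGaussianSeq P Z A)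
    (hZ' : IsStationaryGaussianSeq P' Z' A) (n : ℕ) :
    persistenceProb P Z n = persistenceProb P' Z' n := by
  rw [persistenceProb_eq_fin, persistenceProb_eq_fin]
  exact (hZ.vector fun i : Fin n => (i : ℕ) + 1).measureReal_neg_eq (hZ'.vector _)

/-- Association of the first `m` and the next `n` variables; by stationarity the second block has
the law of the first `n`. -/
lemma persistenceProb_mul_le (hZ : IsStationaryGaussianSeq P Z A) (hA : ∀ k, 0 ≤ A k) (m n : ℕ) :
    persistenceProb P Z m * persistenceProb P Z n ≤ persistenceProb P Z (m + n) := by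
  have h := (hZ.vector (Sum.elim (fun i : Fin m => (i : ℕ) + 1)
    (fun k : Fin n => m + (k + 1)))).mul_le_measureReal_neg fun i k => hA _
  have hn : P.real {ω | ∀ k : Fin n, Z (k + 1) ω < 0} =
      P.real {ω | ∀ k : Fin n, Z (m + (k + 1)) ω < 0} := by
    have h2 := hZ.vector (fun k : Fin n => m + ((k : ℕ) + 1))
    refine (hZ.vector (fun k : Fin n => (k : ℕ) + 1)).measureReal_neg_eq ?_
    convert h2 using 4
    push_cast; ring_nf
  rw [persistenceProb_eq_fin, persistenceProb_eq_fin, persistenceProb_eq_fin, hn]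
  refine h.trans (le_of_eq ?_)
  congr 1
  ext ω
  simp only [Set.mem_ofPred_eq, Sum.forall, Sum.elim_inl, Sum.elim_inr]
  constructor
  · rintro ⟨h1, h2⟩ i
    rcases lt_or_ge (i : ℕ) m with hi | hi
    · exact h1 ⟨i, hi⟩
    · have := h2 ⟨i - m, by omega⟩
      simpa [show m + ((i : ℕ) - m + 1) = i + 1 by omega] using this
  · intro h
    refine ⟨fun i => h ⟨i, by omega⟩, fun k => ?_⟩
    have := h ⟨m + k, by omega⟩
    simpa [add_assoc] using this

lemma persistenceProb_one (hZ : IsStationaryGaussianSeq P Z A) :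
    persistenceProb P Z 1 = (gaussianReal 0 1).real (Set.Iio 0) := by
  have h := (hZ.vector (fun _ : Unit => 1)).map_eq_gaussianReal ()
  simp only [sub_self, hZ.unit_variance, Real.toNNReal_one] at h
  rw [← h, map_measureReal_apply_of_aemeasurable (hZ.gaussian.aemeasurable 1) measurableSet_Iio]
  simp [persistenceProb]
  rfl

lemma persistenceProb_pos (hZ : IsStationaryGaussianSeq P Z A) (hA : ∀ k, 0 ≤ A k) (n : ℕ) :
    0 < persistenceProb P Z n := by
  induction n with
  | zero => simp [persistenceProb]
  | succ n ih =>
    refine lt_of_lt_of_le (mul_pos ih ?_) (hZ.persistenceProb_mul_le hA n 1)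
    rw [hZ.persistenceProb_one]
    exact gaussianReal_real_Iio_pos 0

/-- Fekete's lemma for persistence probabilities. -/
lemma exists_tendsto (hZ : IsStationaryGaussianSeq P Z A) (hA : ∀ k, 0 ≤ A k) :
    ∃ θ : ℝ, Tendsto (fun n : ℕ => -(1 / (n : ℝ) * Real.log (persistenceProb P Z n))) atTop (𝓝 θ) ∧
      ∀ n : ℕ, n ≠ 0 → θ ≤ -Real.log (persistenceProb P Z n) / n := by
  have hsub : Subadditive fun n => -Real.log (persistenceProb P Z n) := fun m n => by
    have h := Real.log_le_log (mul_pos (hZ.persistenceProb_pos hA m) (hZ.persistenceProb_pos hA n))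
      (hZ.persistenceProb_mul_le hA m n)
    rw [Real.log_mul (hZ.persistenceProb_pos hA m).ne' (hZ.persistenceProb_pos hA n).ne'] at h
    linarith
  have hbdd : BddBelow (Set.range fun n : ℕ => -Real.log (persistenceProb P Z n) / n) := by
    refine ⟨0, ?_⟩
    rintro _ ⟨n, rfl⟩
    have : Real.log (persistenceProb P Z n) ≤ 0 :=
      Real.log_nonpos (hZ.persistenceProb_pos hA n).le measureReal_le_one
    exact div_nonneg (by linarith) (by positivity)
  refine ⟨hsub.lim, (hsub.tendsto_lim hbdd).congr fun n => by ring, fun n hn =>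
    hsub.lim_le_div hbdd hn⟩

-- Multiples of a large `k` see only the tail of the summable `A`. Each side of the diagonal
-- contributes at most 1/4 and the diagonal 1, which is the diagonal dominance needed for
-- exponential decay.
omit [IsProbabilityMeasure P] in
lemma exists_sparse (hZ : IsStationaryGaussianSeq P Z A)
    (hs : Summable fun i : ℕ => A i) :
    ∃ k : ℕ, 0 < k ∧ ∀ n (i : Fin n), ∑ j : Fin n, A ((k : ℤ) * ((i : ℤ) - j)) ≤ 3 / 2 := by
  obtain ⟨s, hsv⟩ := summable_iff_vanishing_norm.1 hs (1 / 4) (by norm_num)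
  -- All positive multiples of `k` avoid `s`, outside which finite sums of `A` are below 1/4 in
  -- absolute value.
  set k := s.sup id + 1 with hk
  have key : ∀ (n : ℕ) (F : Finset (Fin n)) (g : Fin n → ℕ), Set.InjOn g F →
      (∀ j ∈ F, 1 ≤ g j) → ∑ j ∈ F, A ((k : ℤ) * g j) ≤ 1 / 4 := by
    intro n F g hg hg1
    have hinj : Set.InjOn (fun j => k * g j) F := fun a ha b hb hab =>
      hg ha hb (Nat.eq_of_mul_eq_mul_left (Nat.succ_pos _) hab)
    have h := hsv (F.image fun j => k * g j) (by
      rw [Finset.disjoint_left]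
      intro x hx hxs
      obtain ⟨j, hj, rfl⟩ := Finset.mem_image.1 hx
      have h1 : k * g j ≤ s.sup id := Finset.le_sup (f := id) hxs
      have h2 : k * 1 ≤ k * g j := Nat.mul_le_mul_left k (hg1 j hj)
      omega)
    rw [Finset.sum_image hinj, Real.norm_eq_abs] at h
    push_cast at h
    exact (le_abs_self _).trans h.le
  refine ⟨k, Nat.succ_pos _, fun n i => ?_⟩
  have h1 := key n (Finset.univ.filter (· < i)) (fun j => (i : ℕ) - j)
    (fun a ha b hb hab => by
      simp only [Finset.coe_filter, Finset.mem_univ, true_and, Set.mem_ofPred_eq] at ha hb hab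
      ext; omega)
    (fun j hj => by simp only [Finset.mem_filter, Finset.mem_univ, true_and] at hj; omega)
  have h2 := key n (Finset.univ.filter (i < ·)) (fun j => (j : ℕ) - i)
    (fun a ha b hb hab => by
      simp only [Finset.coe_filter, Finset.mem_univ, true_and, Set.mem_ofPred_eq] at ha hb hab
      ext; omega)
    (fun j hj => by simp only [Finset.mem_filter, Finset.mem_univ, true_and] at hj; omega)
  have h3 : ∀ j : Fin n, A ((k : ℤ) * ((i : ℤ) - j)) =
      (if j < i then A ((k : ℤ) * (((i : ℕ) - (j : ℕ) : ℕ) : ℤ)) else 0) +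
      (if i < j then A ((k : ℤ) * (((j : ℕ) - (i : ℕ) : ℕ) : ℤ)) else 0) + (if j = i then 1 else 0) := by
    intro j
    rcases lt_trichotomy j i with h | h | h
    · have h' : (j : ℕ) ≤ i := by omega
      simp [h, h.not_gt, h.ne, Nat.cast_sub h']
    · subst h; simp [hZ.unit_variance]
    · have h' : (i : ℕ) ≤ j := by omega
      rw [← hZ.even, ← mul_neg, neg_sub]
      simp [h, h.not_gt, h.ne', Nat.cast_sub h']
  simp_rw [h3, Finset.sum_add_distrib, ← Finset.sum_filter]
  have h4 : ∑ j ∈ Finset.univ.filter (· = i), (1 : ℝ) = 1 := by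
    simp [Finset.filter_eq']
  linarith

/-- Persistence up to time `k * n` implies negativity at `n` sparse times, of probability at most `q
^ n`; hence θ ≥ -log q / k. -/
lemma exponent_pos (hZ : IsStationaryGaussianSeq P Z A) (hA : ∀ k, 0 ≤ A k)
    (hs : Summable fun i : ℕ => A i) {θ : ℝ}
    (hθ : Tendsto (fun n : ℕ => -(1 / (n : ℝ) * Real.log (persistenceProb P Z n))) atTop (𝓝 θ)) :
    0 < θ := by
  obtain ⟨k, hk, hrow⟩ := hZ.exists_sparse hs
  obtain ⟨q, hq0, hq1, hq⟩ := exists_measureReal_neg_le_pow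
  have hlq := Real.log_neg hq0 hq1
  have h1 : ∀ n : ℕ, persistenceProb P Z (k * n) ≤ q ^ n := by
    intro n
    have h := hq P _ _ (hZ.vector (fun i : Fin n => k * (i + 1)))
      (fun i => by simp [hZ.unit_variance]) (fun i j => hA _) (fun i => by
        refine le_trans (le_of_eq ?_) (hrow n i)
        refine Finset.sum_congr rfl fun j _ => ?_
        congr 1; push_cast; ring)
    rw [Fintype.card_fin] at h
    refine le_trans (measureReal_mono (s₂ := {ω | ∀ i : Fin n, Z (k * (i + 1)) ω < 0})
      fun ω hω i => ?_) h
    exact hω _ (Finset.mem_Icc.2 ⟨Nat.mul_pos hk (by omega), Nat.mul_le_mul_left k (by omega)⟩)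
  have h2 : Tendsto (fun n : ℕ => k * n) atTop atTop :=
    tendsto_id.const_mul_atTop' hk
  have h3 := hθ.comp h2
  have hkR : (0 : ℝ) < k := by exact_mod_cast hk
  refine lt_of_lt_of_le (div_pos (neg_pos.2 hlq) hkR) (ge_of_tendsto h3 ?_)
  filter_upwards [eventually_gt_atTop 0] with n hn
  have hnR : (0 : ℝ) < n := by exact_mod_cast hn
  have h4 := Real.log_le_log (hZ.persistenceProb_pos hA (k * n)) (h1 n)
  rw [Real.log_pow] at h4
  simp only [Function.comp_apply]
  push_cast
  rw [div_le_iff₀ hkR]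
  have : -(1 / ((k : ℝ) * n) * Real.log (persistenceProb P Z (k * n))) * k =
      -Real.log (persistenceProb P Z (k * n)) / n := by field_simp
  rw [this, le_div_iff₀ hnR]
  linarith

/-- If Z_1 < -1 and every other variable is within distance 1 of Z_1, all are negative. The
exceptional events are controlled by Markov's inequality and E(Z_{i+1} - Z_1)² = 2(1 - A(i)). -/
lemma le_persistenceProb (hZ : IsStationaryGaussianSeq P Z A) (N : ℕ) :
    (gaussianReal 0 1).real (Set.Iio (-1)) - ∑ i ∈ Finset.range N, 2 * (1 - A i) ≤
      persistenceProb P Z N := by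
  have hm := hZ.gaussian.aemeasurable
  have h0 : P.real {ω | Z 1 ω < -1} = (gaussianReal 0 1).real (Set.Iio (-1)) := by
    have h := (hZ.vector (fun _ : Unit => 1)).map_eq_gaussianReal ()
    simp only [sub_self, hZ.unit_variance, Real.toNNReal_one] at h
    rw [← h, map_measureReal_apply_of_aemeasurable (hm 1) measurableSet_Iio]
    rfl
  have h1 : ∀ i : ℕ, P.real {ω | 1 ≤ (Z (i + 1) ω - Z 1 ω) ^ 2} ≤ 2 * (1 - A i) := by
    intro i
    have hv := (hZ.vector (fun b : Bool => if b then i + 1 else 1))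
    have hsq := hv.integral_sum_sq (fun b => if b then 1 else -1)
    have hint : Integrable (fun ω => (Z (i + 1) ω - Z 1 ω) ^ 2) P := by
      have h1 := hv.memLp_two true
      have h2 := hv.memLp_two false
      exact (h1.sub h2).integrable_sq
    have hmk := mul_meas_ge_le_integral_of_nonneg (μ := P)
      (Eventually.of_forall fun ω => sq_nonneg (Z (i + 1) ω - Z 1 ω)) hint 1
    have e : ∫ ω, (Z (i + 1) ω - Z 1 ω) ^ 2 ∂P = 2 * (1 - A i) := by
      have he := hZ.even i
      simp [hZ.unit_variance] at hsq
      rw [he] at hsq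
      have : ∀ ω, (Z (i + 1) ω - Z 1 ω) ^ 2 = (Z (i + 1) ω + -Z 1 ω) ^ 2 := fun ω => by ring
      simp_rw [this, hsq]
      ring
    rw [e, one_mul] at hmk
    exact hmk
  have hsub : {ω | Z 1 ω < -1} ⊆ {ω | ∀ ℓ ∈ Finset.Icc 1 N, Z ℓ ω < 0} ∪
      ⋃ i ∈ Finset.range N, {ω | 1 ≤ (Z (i + 1) ω - Z 1 ω) ^ 2} := by
    intro ω hω
    by_contra hc
    simp only [Set.mem_union, Set.mem_ofPred_eq, Set.mem_iUnion, not_or, not_forall, not_exists,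
      not_lt, not_le] at hc
    obtain ⟨⟨l, hl, hl0⟩, h2⟩ := hc
    rw [Finset.mem_Icc] at hl
    have h3 := h2 (l - 1) (Finset.mem_range.2 (by omega))
    rw [Nat.sub_add_cancel hl.1] at h3
    have h4 : Z 1 ω < -1 := hω
    nlinarith
  have h2 := (measureReal_mono (μ := P) hsub).trans (measureReal_union_le _ _)
  have h3 := measureReal_biUnion_finset_le (μ := P) (Finset.range N)
    (fun i => {ω | 1 ≤ (Z (i + 1) ω - Z 1 ω) ^ 2})
  have h4 := Finset.sum_le_sum fun i (_ : i ∈ Finset.range N) => h1 i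
  rw [h0] at h2
  unfold persistenceProb
  linarith

end IsStationaryGaussianSeq

/-- Non-negative summable correlation functions have a positive and finite persistence exponent. -/
theorem IsCorrelationFunction.exists_hasPersistenceExponent {A : ℤ → ℝ}
    (hA : IsCorrelationFunction A) (hA0 : ∀ k, 0 ≤ A k) (hs : Summable fun i : ℕ => A i) :
    ∃ θ : ℝ, 0 < θ ∧ HasPersistenceExponent.{v} A θ ∧ HasPersistenceExponent.{u} A θ ∧
      ∀ N : ℕ, N ≠ 0 → ∀ p : ℝ, 0 < p →
        p ≤ (gaussianReal 0 1).real (Set.Iio (-1)) - ∑ i ∈ Finset.range N, 2 * (1 - A i) →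
        θ ≤ -Real.log p / N := by
  obtain ⟨Ω, _, P, _, Z, hZ⟩ := hA
  obtain ⟨θ, hθ, hinf⟩ := hZ.exists_tendsto hA0
  refine ⟨θ, hZ.exponent_pos hA0 hs hθ, ⟨hZ.isCorrelationFunction, ?_⟩,
    ⟨hZ.isCorrelationFunction, ?_⟩, fun N hN p hp hle => (hinf N hN).trans ?_⟩
  · intro Ω' _ P' _ Z' hZ'
    simp_rw [hZ'.persistenceProb_congr hZ]
    exact hθ
  · intro Ω' _ P' _ Z' hZ'
    simp_rw [hZ'.persistenceProb_congr hZ]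
    exact hθ
  · have := Real.log_le_log hp (hle.trans (hZ.le_persistenceProb N))
    gcongr

/-- The persistence exponent of strongly correlated sequences is small. -/
lemma exists_forall_exponent_lt {θ₀ : ℝ} (hθ₀ : 0 < θ₀) : ∃ β : ℝ, 0 < β ∧
    ∀ A : ℤ → ℝ, IsCorrelationFunction A → (∀ k, 0 ≤ A k) → Summable (fun i : ℕ => A i) →
      (∀ k : ℕ, Real.exp (-(k : ℝ) * β) ≤ A k) →
      ∃ θ : ℝ, θ < θ₀ ∧ HasPersistenceExponent.{v} A θ := by
  set κ := (gaussianReal 0 1).real (Set.Iio (-1 : ℝ)) with hκdef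
  have hκ : 0 < κ := gaussianReal_real_Iio_pos _
  -- `N` is chosen first, so that a probability of at least `κ / 2` at time `N` forces the exponent
  -- below `θ₀`; then `β` is taken so small that the Markov errors total less than the other `κ /
  -- 2`.
  obtain ⟨N, hN⟩ := exists_nat_gt (-Real.log (κ / 2) / θ₀)
  have hκ1 : κ < 1 := gaussianReal_real_Iio_lt_one _
  have hlog : 0 < -Real.log (κ / 2) := by
    have := Real.log_neg (x := κ / 2) (by positivity) (by linarith); linarith
  have hN0 : (0 : ℝ) < N := lt_trans (div_pos hlog hθ₀) hN
  have hcont : Tendsto (fun β : ℝ => ∑ i ∈ Finset.range N, 2 * (1 - Real.exp (-(i : ℝ) * β)))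
      (𝓝[>] 0) (𝓝 0) := by
    have h : Continuous (fun β : ℝ => ∑ i ∈ Finset.range N, 2 * (1 - Real.exp (-(i : ℝ) * β))) := by
      fun_prop
    have h2 := h.tendsto 0
    simp at h2
    simpa using h2.mono_left nhdsWithin_le_nhds
  obtain ⟨β, hβ, hβ0⟩ := ((hcont.eventually (gt_mem_nhds (half_pos hκ))).and
    self_mem_nhdsWithin).exists
  refine ⟨β, hβ0, fun A hA hA0 hs hle => ?_⟩
  obtain ⟨θ, -, h1, -, h2⟩ := hA.exists_hasPersistenceExponent.{v, v} hA0 hs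
  refine ⟨θ, lt_of_le_of_lt (h2 N (by exact_mod_cast hN0.ne') (κ / 2) (half_pos hκ) ?_) ?_, h1⟩
  · have : ∑ i ∈ Finset.range N, 2 * (1 - A i) ≤
        ∑ i ∈ Finset.range N, 2 * (1 - Real.exp (-(i : ℝ) * β)) :=
      Finset.sum_le_sum fun i _ => by have := hle i; linarith
    linarith
  · rw [div_lt_iff₀ hθ₀] at hN
    rw [div_lt_iff₀ hN0]
    linarith

/-! ### Estimates for the transform of correlation functions -/

section ExpCorr

/-- The terms of the numerator of `expCorr`. -/
noncomputable def expTerm (α : ℝ) (ρ : ℤ → ℝ) (τ : ℤ) (p : ℕ × ℕ) : ℝ :=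
  Real.exp (-((p.1 : ℝ) + (p.2 : ℝ)) * α) * ρ ((p.1 : ℤ) - (p.2 : ℤ) - τ)

/-- The numerator of `expCorr`. -/
noncomputable def expNum (α : ℝ) (ρ : ℤ → ℝ) (τ : ℤ) : ℝ := ∑' p, expTerm α ρ τ p

lemma expCorr_eq (α : ℝ) (ρ : ℤ → ℝ) (τ : ℤ) : expCorr α ρ τ = expNum α ρ τ / expNum α ρ 0 := by
  simp only [expCorr, expNum, expTerm, sub_zero]

variable {α : ℝ} {ρ : ℤ → ℝ}

lemma summable_exp_neg_nat_mul (hα : 0 < α) : Summable fun a : ℕ => Real.exp (-(a : ℝ) * α) := by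
  have h := summable_geometric_of_lt_one (Real.exp_pos (-α)).le (Real.exp_lt_one_iff.2 (by linarith))
  refine h.congr fun n => ?_
  rw [← Real.exp_nat_mul]; congr 1; ring

lemma summable_exp_neg_add_mul (hα : 0 < α) :
    Summable fun p : ℕ × ℕ => Real.exp (-((p.1 : ℝ) + (p.2 : ℝ)) * α) := by
  have h := summable_exp_neg_nat_mul hα
  refine (h.mul_of_nonneg h (fun _ => (Real.exp_pos _).le) fun _ => (Real.exp_pos _).le).congr
    fun p => ?_
  rw [← Real.exp_add]; congr 1; ring

lemma summable_int (he : ∀ k, ρ (-k) = ρ k) (hs : Summable fun i : ℕ => ρ i) : Summable ρ :=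
  Summable.of_nat_of_neg hs (by simpa [he] using hs)

lemma expTerm_nonneg (hn : ∀ k, 0 ≤ ρ k) (τ : ℤ) (p : ℕ × ℕ) : 0 ≤ expTerm α ρ τ p :=
  mul_nonneg (Real.exp_pos _).le (hn _)

lemma summable_expTerm (hα : 0 < α) (hn : ∀ k, 0 ≤ ρ k) (he : ∀ k, ρ (-k) = ρ k)
    (hs : Summable fun i : ℕ => ρ i) (τ : ℤ) : Summable (expTerm α ρ τ) := by
  have hρ := summable_int he hs
  refine Summable.of_nonneg_of_le (expTerm_nonneg hn τ) (fun p => ?_)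
    ((summable_exp_neg_add_mul hα).mul_right (∑' k, ρ k))
  exact mul_le_mul_of_nonneg_left (hρ.le_tsum _ fun k _ => hn k) (Real.exp_pos _).le

lemma expNum_nonneg (hn : ∀ k, 0 ≤ ρ k) (τ : ℤ) : 0 ≤ expNum α ρ τ :=
  tsum_nonneg (expTerm_nonneg hn τ)

lemma expNum_zero_pos (hα : 0 < α) (hn : ∀ k, 0 ≤ ρ k) (he : ∀ k, ρ (-k) = ρ k)
    (hs : Summable fun i : ℕ => ρ i) (h0 : ρ 0 = 1) : 0 < expNum α ρ 0 := by
  refine lt_of_lt_of_le zero_lt_one (le_trans (le_of_eq ?_)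
    ((summable_expTerm hα hn he hs 0).le_tsum (0, 0) fun p _ => expTerm_nonneg hn 0 p))
  simp [expTerm, h0]

lemma expNum_neg (he : ∀ k, ρ (-k) = ρ k) (τ : ℤ) : expNum α ρ (-τ) = expNum α ρ τ := by
  unfold expNum
  rw [← (Equiv.prodComm ℕ ℕ).tsum_eq]
  refine tsum_congr fun p => ?_
  simp only [expTerm, Equiv.prodComm_apply, Prod.fst_swap, Prod.snd_swap]
  rw [← he, add_comm (p.2 : ℝ)]
  congr 2
  ring

/-- Raising the first index by `τ` compensates the shift in the argument of ρ and multiplies the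
weight by e^{-τα}; the terms not reached by this injection are non-negative. -/
lemma expNum_add_le (hα : 0 < α) (hn : ∀ k, 0 ≤ ρ k) (he : ∀ k, ρ (-k) = ρ k)
    (hs : Summable fun i : ℕ => ρ i) (k : ℤ) (τ : ℕ) :
    Real.exp (-(τ : ℝ) * α) * expNum α ρ k ≤ expNum α ρ (k + τ) := by
  have h := tsum_comp_le_tsum_of_inj (summable_expTerm hα hn he hs (k + τ)) (expTerm_nonneg hn _)
    (i := fun p : ℕ × ℕ => (p.1 + τ, p.2)) (fun p q h => by
      simp only [Prod.mk.injEq, add_left_inj] at h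
      exact Prod.ext h.1 h.2)
  refine le_trans (le_of_eq ?_) h
  unfold expNum
  rw [← tsum_mul_left]
  refine tsum_congr fun p => ?_
  simp only [expTerm, Function.comp_apply]
  rw [← mul_assoc, ← Real.exp_add]
  congr 2
  · push_cast; ring
  · push_cast; ring

lemma expNum_sub_le (hα : 0 < α) (hn : ∀ k, 0 ≤ ρ k) (he : ∀ k, ρ (-k) = ρ k)
    (hs : Summable fun i : ℕ => ρ i) (k : ℤ) (τ : ℕ) :
    Real.exp (-(τ : ℝ) * α) * expNum α ρ k ≤ expNum α ρ (k - τ) := by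
  have h := expNum_add_le hα hn he hs (-k) τ
  rwa [expNum_neg he, ← expNum_neg he (-k + τ), neg_add, neg_neg, ← sub_eq_add_neg] at h

/-- For fixed indices the arguments of ρ are distinct as `τ` varies, so summing over `τ` first costs
at most the total mass of ρ. -/
lemma summable_expNum (hα : 0 < α) (hn : ∀ k, 0 ≤ ρ k) (he : ∀ k, ρ (-k) = ρ k)
    (hs : Summable fun i : ℕ => ρ i) : Summable fun τ : ℕ => expNum α ρ τ := by
  have hρ := summable_int he hs
  refine summable_of_sum_le (c := ∑' p : ℕ × ℕ, Real.exp (-((p.1 : ℝ) + (p.2 : ℝ)) * α) * ∑' k, ρ k)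
    (fun τ => expNum_nonneg hn τ) fun F => ?_
  simp only [expNum]
  rw [← Summable.tsum_finsetSum fun τ _ => summable_expTerm hα hn he hs _]
  refine Summable.tsum_le_tsum (fun p => ?_)
    (summable_sum fun τ _ => summable_expTerm hα hn he hs _)
    ((summable_exp_neg_add_mul hα).mul_right _)
  simp only [expTerm]
  rw [← Finset.mul_sum]
  refine mul_le_mul_of_nonneg_left ?_ (Real.exp_pos _).le
  have hinj : Function.Injective fun τ : ℕ => (p.1 : ℤ) - p.2 - τ := fun a b h => by
    simpa using h
  rw [← Finset.sum_image (f := ρ) fun a _ b _ h => hinj h]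
  exact hρ.sum_le_tsum _ fun k _ => hn k

lemma expCorr_nonneg (hn : ∀ k, 0 ≤ ρ k) (τ : ℤ) : 0 ≤ expCorr α ρ τ := by
  rw [expCorr_eq]
  exact div_nonneg (expNum_nonneg hn _) (expNum_nonneg hn _)

lemma summable_expCorr (hα : 0 < α) (hn : ∀ k, 0 ≤ ρ k) (he : ∀ k, ρ (-k) = ρ k)
    (hs : Summable fun i : ℕ => ρ i) : Summable fun τ : ℕ => expCorr α ρ τ := by
  simp_rw [expCorr_eq]
  exact (summable_expNum hα hn he hs).div_const _

lemma le_expCorr (hα : 0 < α) (hn : ∀ k, 0 ≤ ρ k) (he : ∀ k, ρ (-k) = ρ k)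
    (hs : Summable fun i : ℕ => ρ i) (h0 : ρ 0 = 1) (τ : ℕ) :
    Real.exp (-(τ : ℝ) * α) ≤ expCorr α ρ τ := by
  rw [expCorr_eq, le_div_iff₀ (expNum_zero_pos hα hn he hs h0)]
  simpa using expNum_add_le hα hn he hs 0 τ

/-- Lower bound for the iterated transform. -/
lemma le_expCorr_expCorr {β : ℝ} (hα : 0 < α) (hβ : 0 < β) (hn : ∀ k, 0 ≤ ρ k)
    (he : ∀ k, ρ (-k) = ρ k) (hs : Summable fun i : ℕ => ρ i) (h0 : ρ 0 = 1) (τ : ℕ) :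
    Real.exp (-(τ : ℝ) * β) ≤ expCorr α (expCorr β ρ) τ := by
  have hn' : ∀ k, 0 ≤ expCorr β ρ k := expCorr_nonneg hn
  have he' : ∀ k, expCorr β ρ (-k) = expCorr β ρ k := fun k => by
    rw [expCorr_eq, expCorr_eq, expNum_neg he]
  have hs' := summable_expCorr hβ hn he hs
  have hN := expNum_zero_pos hβ hn he hs h0
  have h0' : expCorr β ρ 0 = 1 := by rw [expCorr_eq, div_self hN.ne']
  rw [expCorr_eq, le_div_iff₀ (expNum_zero_pos hα hn' he' hs' h0')]
  unfold expNum
  rw [← tsum_mul_left]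
  -- The shift estimate for the inner transform holds at every lag, hence term by term in the outer
  -- sum.
  refine Summable.tsum_le_tsum (fun p => ?_) ((summable_expTerm hα hn' he' hs' 0).mul_left _)
    (summable_expTerm hα hn' he' hs' τ)
  simp only [expTerm, sub_zero]
  rw [mul_left_comm]
  refine mul_le_mul_of_nonneg_left ?_ (Real.exp_pos _).le
  rw [expCorr_eq, expCorr_eq, ← mul_div_assoc]
  exact div_le_div_of_nonneg_right (expNum_sub_le hβ hn he hs _ τ) hN.le

end ExpCorr

/-! ### The stationary exponential moving average -/

section MovingAverage

variable {Ω : Type*} [MeasurableSpace Ω] {P : Measure Ω} [IsProbabilityMeasure P]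
  {ξ : ℕ → Ω → ℝ} {ρ : ℤ → ℝ} {α : ℝ}

/-- The truncated exponential moving average. -/
noncomputable def truncAverage (α : ℝ) (ξ : ℕ → Ω → ℝ) (L m : ℕ) (ω : Ω) : ℝ :=
  ∑ a ∈ Finset.range L, Real.exp (-(a : ℝ) * α) * ξ (m + a) ω

/-- The exponential moving average. -/
noncomputable def expAverage (α : ℝ) (ξ : ℕ → Ω → ℝ) (m : ℕ) (ω : Ω) : ℝ :=
  ∑' a : ℕ, Real.exp (-(a : ℝ) * α) * ξ (m + a) ω

/-- Finite exponentially weighted sums form centered Gaussian vectors. -/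
lemma IsStationaryGaussianSeq.weighted_vector {ι : Type*} [Fintype ι] (hξ : IsStationaryGaussianSeq P ξ ρ)
    (α : ℝ) (L : ι → ℕ) (e : ι → ℕ → ℕ) :
    IsCenteredGaussianVector P
      (fun i ω => ∑ a ∈ Finset.range (L i), Real.exp (-(a : ℝ) * α) * ξ (e i a) ω)
      (fun i j => ∑ p ∈ Finset.range (L i) ×ˢ Finset.range (L j),
        Real.exp (-((p.1 : ℝ) + p.2) * α) * ρ ((e i p.1 : ℤ) - e j p.2)) := by
  classical
  have h := (hξ.vector (fun s : (Σ i : ι, Fin (L i)) => e s.1 s.2)).linear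
    (fun (i : ι) s => if s.1 = i then Real.exp (-((s.2 : ℕ) : ℝ) * α) else 0)
  have e1 : ∀ i ω, ∑ s : (Σ i : ι, Fin (L i)),
      (if s.1 = i then Real.exp (-((s.2 : ℕ) : ℝ) * α) else 0) * ξ (e s.1 s.2) ω =
      ∑ a ∈ Finset.range (L i), Real.exp (-(a : ℝ) * α) * ξ (e i a) ω := by
    intro i ω
    rw [Fintype.sum_sigma, Finset.sum_eq_single i, ← Fin.sum_univ_eq_sum_range
      (fun a => Real.exp (-(a : ℝ) * α) * ξ (e i a) ω)]
    · simp
    · intro j _ hj; simp [hj]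
    · simp
  have e2 : ∀ i j, ∑ s : (Σ i : ι, Fin (L i)), ∑ t : (Σ i : ι, Fin (L i)),
      (if s.1 = i then Real.exp (-((s.2 : ℕ) : ℝ) * α) else 0) *
      (if t.1 = j then Real.exp (-((t.2 : ℕ) : ℝ) * α) else 0) *
      ρ ((e s.1 s.2 : ℤ) - e t.1 t.2) =
      ∑ p ∈ Finset.range (L i) ×ˢ Finset.range (L j),
        Real.exp (-((p.1 : ℝ) + p.2) * α) * ρ ((e i p.1 : ℤ) - e j p.2) := by
    intro i j
    rw [Finset.sum_product, Fintype.sum_sigma, Finset.sum_eq_single i,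
      ← Fin.sum_univ_eq_sum_range (fun a => ∑ b ∈ Finset.range (L j),
        Real.exp (-((a : ℝ) + b) * α) * ρ ((e i a : ℤ) - e j b))]
    · refine Finset.sum_congr rfl fun a _ => ?_
      rw [Fintype.sum_sigma, Finset.sum_eq_single j, ← Fin.sum_univ_eq_sum_range
        (fun b => Real.exp (-(((a : ℕ) : ℝ) + b) * α) * ρ ((e i a : ℤ) - e j b))]
      · refine Finset.sum_congr rfl fun b _ => ?_
        simp only [if_true]
        rw [← Real.exp_add]
        congr 2; ring
      · intro k _ hk; simp [hk]
      · simp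
    · intro k _ hk; simp [hk]
    · simp
  simp_rw [e1, e2] at h
  exact h

lemma IsStationaryGaussianSeq.truncAverage_vector {ι : Type*} [Fintype ι]
    (hξ : IsStationaryGaussianSeq P ξ ρ) (α : ℝ) (L m : ι → ℕ) :
    IsCenteredGaussianVector P (fun i => truncAverage α ξ (L i) (m i))
      (fun i j => ∑ p ∈ Finset.range (L i) ×ˢ Finset.range (L j),
        expTerm α ρ ((m j : ℤ) - m i) p) := by
  have h := hξ.weighted_vector α L (fun i a => m i + a)
  have e : ∀ i j, ∑ p ∈ Finset.range (L i) ×ˢ Finset.range (L j),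
      Real.exp (-((p.1 : ℝ) + p.2) * α) * ρ (((m i + p.1 : ℕ) : ℤ) - (m j + p.2 : ℕ)) =
      ∑ p ∈ Finset.range (L i) ×ˢ Finset.range (L j), expTerm α ρ ((m j : ℤ) - m i) p := by
    intro i j
    refine Finset.sum_congr rfl fun p _ => ?_
    simp only [expTerm]
    congr 2
    push_cast; ring
  simp_rw [e] at h
  exact h

/-- All ξ_i have the same L² norm, so the L² norms of the terms form a convergent geometric series.
-/
lemma IsStationaryGaussianSeq.ae_summable (hξ : IsStationaryGaussianSeq P ξ ρ) (hα : 0 < α)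
    (m : ℕ) : ∀ᵐ ω ∂P, Summable fun a : ℕ => Real.exp (-(a : ℝ) * α) * ξ (m + a) ω := by
  have hm := hξ.gaussian.aemeasurable
  have hnorm : ∀ i, eLpNorm (ξ i) 2 P = eLpNorm id 2 (gaussianReal 0 1) := fun i => by
    have h := (hξ.vector (fun _ : Unit => i)).map_eq_gaussianReal ()
    simp only [sub_self, hξ.unit_variance, Real.toNNReal_one] at h
    rw [← h, eLpNorm_map_measure (by fun_prop) (hm i)]
    rfl
  have h := summable_norm_of_tsum_eLpNorm_ne_top (μ := P) (p := 2) one_le_two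
    (f := fun (a : ℕ) ω => Real.exp (-(a : ℝ) * α) * ξ (m + a) ω)
    (fun a => ((hm _).const_mul _).aestronglyMeasurable) ?_
  · filter_upwards [h] with ω hω using hω.of_norm
  · have e : ∀ a : ℕ, eLpNorm (fun ω => Real.exp (-(a : ℝ) * α) * ξ (m + a) ω) 2 P =
        ‖Real.exp (-(a : ℝ) * α)‖ₑ * eLpNorm id 2 (gaussianReal 0 1) := fun a => by
      rw [← hnorm (m + a), ← eLpNorm_const_smul]
      rfl
    simp_rw [e]
    rw [ENNReal.tsum_mul_right]
    refine ENNReal.mul_ne_top ?_ ?_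
    · exact tsum_enorm_ne_top_iff_summable_norm.2 (summable_exp_neg_nat_mul hα).norm
    · exact (IsGaussian.memLp_two_id (μ := gaussianReal 0 1)).eLpNorm_ne_top

lemma IsStationaryGaussianSeq.ae_tendsto_truncAverage (hξ : IsStationaryGaussianSeq P ξ ρ)
    (hα : 0 < α) (m : ℕ) {L : ℕ → ℕ} (hL : Tendsto L atTop atTop) :
    ∀ᵐ ω ∂P, Tendsto (fun n => truncAverage α ξ (L n) m ω) atTop
      (𝓝 (expAverage α ξ m ω)) := by
  filter_upwards [hξ.ae_summable hα m] with ω hω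
  exact hω.hasSum.tendsto_sum_nat.comp hL

lemma IsStationaryGaussianSeq.expAverage_vector {ι : Type*} [Fintype ι]
    (hξ : IsStationaryGaussianSeq P ξ ρ) (hα : 0 < α) (hn : ∀ k, 0 ≤ ρ k)
    (hs : Summable fun i : ℕ => ρ i) (m : ι → ℕ) :
    IsCenteredGaussianVector P (fun i => expAverage α ξ (m i))
      (fun i j => expNum α ρ ((m i : ℤ) - m j)) := by
  refine IsCenteredGaussianVector.of_tendsto (fun n => hξ.truncAverage_vector α (fun _ => n) m)
    (fun i => hξ.ae_tendsto_truncAverage hα (m i) tendsto_id) fun i j => ?_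
  rw [← expNum_neg hξ.even, neg_sub]
  have h : Tendsto (fun s => ∑ p ∈ s, expTerm α ρ ((m j : ℤ) - m i) p) atTop
      (𝓝 (expNum α ρ ((m j : ℤ) - m i))) := by
    have := (summable_expTerm (α := α) hα hn hξ.even hs ((m j : ℤ) - m i)).hasSum
    simpa only [HasSum, SummationFilter.unconditional_filter, expNum] using this
  have h2 : Tendsto (fun n : ℕ => Finset.range n ×ˢ Finset.range n) atTop atTop := by
    have h3 : Tendsto (fun n : ℕ => (Finset.range n, Finset.range n)) atTop (atTop ×ˢ atTop) :=
      tendsto_finset_range.prodMk tendsto_finset_range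
    rw [prod_atTop_atTop_eq] at h3
    exact tendsto_finsetProd_atTop.comp h3
  exact h.comp h2

/-- The normalized exponential moving average is a stationary Gaussian sequence with correlation
function `expCorr α ρ`. -/
lemma IsStationaryGaussianSeq.expAverage_div (hξ : IsStationaryGaussianSeq P ξ ρ) (hα : 0 < α)
    (hn : ∀ k, 0 ≤ ρ k) (hs : Summable fun i : ℕ => ρ i) :
    IsStationaryGaussianSeq P
      (fun m ω => (Real.sqrt (expNum α ρ 0))⁻¹ * expAverage α ξ m ω) (expCorr α ρ) := by
  have hN := expNum_zero_pos hα hn hξ.even hs hξ.unit_variance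
  have h : ∀ {ι : Type} [Fintype ι] (m : ι → ℕ), IsCenteredGaussianVector P
      (fun i ω => (Real.sqrt (expNum α ρ 0))⁻¹ * expAverage α ξ (m i) ω)
      (fun i j => expCorr α ρ ((m i : ℤ) - m j)) := fun m => by
    have h1 := (hξ.expAverage_vector hα hn hs m).smul (Real.sqrt (expNum α ρ 0))⁻¹
    have e : (fun i j => expCorr α ρ ((m i : ℤ) - m j)) = ((Real.sqrt (expNum α ρ 0))⁻¹ ^ 2 •
        (fun i j => expNum α ρ ((m i : ℤ) - m j) : Matrix _ _ ℝ)) := by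
      ext i j
      simp only [Pi.smul_apply]
      rw [inv_pow, Real.sq_sqrt hN.le, expCorr_eq, smul_eq_mul]
      ring
    rw [e]
    exact h1
  refine ⟨IsCenteredGaussianVector.isGaussianProcess (K := fun i j => expCorr α ρ ((i : ℤ) - j))
    fun s => h fun i : s => (i : ℕ), fun i => (h fun _ : Unit => i).integral_eq_zero (), ?_,
    fun i j => (h fun b : Bool => if b then i else j).integral_mul true false⟩
  rw [expCorr_eq, div_self hN.ne']

omit [IsProbabilityMeasure P] in
lemma IsStationaryGaussianSeq.persistenceProb_expAverage_div (hξ : IsStationaryGaussianSeq P ξ ρ)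
    (hα : 0 < α) (hn : ∀ k, 0 ≤ ρ k) (hs : Summable fun i : ℕ => ρ i) (n : ℕ) :
    persistenceProb P (fun m ω => (Real.sqrt (expNum α ρ 0))⁻¹ * expAverage α ξ m ω) n =
      persistenceProb P (expAverage α ξ) n := by
  have hN := expNum_zero_pos hα hn hξ.even hs hξ.unit_variance
  unfold persistenceProb
  congr 1
  ext ω
  simp only [Set.mem_ofPred_eq]
  refine forall₂_congr fun l _ => ?_
  have h : 0 < (Real.sqrt (expNum α ρ 0))⁻¹ := by positivity
  constructor
  · intro h1
    exact (pos_iff_neg_of_mul_neg h1).1 h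
  · exact mul_neg_of_pos_of_neg h

/-- Negative orthant probabilities are continuous along almost surely convergent centered Gaussian
vectors whose limit has non-degenerate coordinates. -/
lemma IsCenteredGaussianVector.tendsto_measureReal_neg {ι : Type*} [Fintype ι]
    {X : ι → Ω → ℝ} {S : Matrix ι ι ℝ} {Z : ℕ → ι → Ω → ℝ} {R : ℕ → Matrix ι ι ℝ}
    (hX : IsCenteredGaussianVector P X S) (hS : ∀ i, 0 < S i i)
    (hZ : ∀ n, IsCenteredGaussianVector P (Z n) (R n))
    (hlim : ∀ i, ∀ᵐ ω ∂P, Tendsto (fun n => Z n i ω) atTop (𝓝 (X i ω))) :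
    Tendsto (fun n => P.real {ω | ∀ i, Z n i ω < 0}) atTop (𝓝 (P.real {ω | ∀ i, X i ω < 0})) := by
  have hne : ∀ i, ∀ᵐ ω ∂P, X i ω ≠ 0 := fun i => by
    have h := hX.map_eq_gaussianReal i
    have := nullSingletonClass_gaussianReal (μ := 0) (v := (S i i).toNNReal) (by simpa using hS i)
    have h0 : P.map (X i) {0} = 0 := by rw [h]; exact measure_singleton 0
    rw [Measure.map_apply_of_aemeasurable (hX.aemeasurable i) (measurableSet_singleton 0)] at h0
    exact measure_eq_zero_iff_ae_notMem.1 h0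
  rw [hX.measureReal_neg_eq_integral]
  simp_rw [fun n => (hZ n).measureReal_neg_eq_integral]
  refine tendsto_integral_of_dominated_convergence (fun _ => 1) (fun n => ?_)
    (integrable_const _) (fun n => Eventually.of_forall fun ω => ?_) ?_
  · refine (Finset.aemeasurable_fun_prod _ fun i _ => ?_).aestronglyMeasurable
    have : Measurable fun x : ℝ => if x < 0 then (1 : ℝ) else 0 :=
      Measurable.ite measurableSet_Iio measurable_const measurable_const
    exact this.comp_aemeasurable ((hZ n).aemeasurable i)
  · rw [Real.norm_eq_abs, Finset.abs_prod]
    exact Finset.prod_le_one (fun i _ => abs_nonneg _) fun i _ => by split_ifs <;> simp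
  · filter_upwards [ae_all_iff.2 hlim, ae_all_iff.2 hne] with ω h1 h2
    refine tendsto_finsetProd _ fun i _ => tendsto_const_nhds.congr' ?_
    rcases lt_or_gt_of_ne (h2 i) with h | h
    · filter_upwards [(h1 i).eventually (gt_mem_nhds h)] with n hn
      rw [if_pos h, if_pos hn]
    · filter_upwards [(h1 i).eventually (lt_mem_nhds h)] with n hn
      rw [if_neg h.not_gt, if_neg hn.not_gt]

lemma IsStationaryGaussianSeq.tendsto_measureReal_truncAverage {ι : Type*} [Fintype ι]
    (hξ : IsStationaryGaussianSeq P ξ ρ) (hα : 0 < α) (hn : ∀ k, 0 ≤ ρ k)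
    (hs : Summable fun i : ℕ => ρ i) (m : ι → ℕ) {L : ℕ → ι → ℕ}
    (hL : ∀ i, Tendsto (fun n => L n i) atTop atTop) :
    Tendsto (fun n => P.real {ω | ∀ i, truncAverage α ξ (L n i) (m i) ω < 0}) atTop
      (𝓝 (P.real {ω | ∀ i, expAverage α ξ (m i) ω < 0})) := by
  refine (hξ.expAverage_vector hα hn hs m).tendsto_measureReal_neg (fun i => ?_)
    (fun n => hξ.truncAverage_vector α (L n) m) fun i => hξ.ae_tendsto_truncAverage hα (m i) (hL i)
  rw [sub_self]
  exact expNum_zero_pos hα hn hξ.even hs hξ.unit_variance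

end MovingAverage

/-! ### Comparison of the weighted sums with the moving average -/

section WeightedSum

variable {Ω : Type*} [MeasurableSpace Ω] {P : Measure Ω} [IsProbabilityMeasure P]
  {ξ : ℕ → Ω → ℝ} {ρ : ℤ → ℝ} {α : ℝ}

omit [MeasurableSpace Ω] in
/-- The weighted sum, normalized by its largest weight. -/
lemma weightedSum_exp_eq (ξ : ℕ → Ω → ℝ) (α : ℝ) (l : ℕ) (ω : Ω) :
    weightedSum (fun i => Real.exp (α * (i : ℝ))) ξ l ω =
      Real.exp (α * l) * ∑ a ∈ Finset.range l, Real.exp (-(a : ℝ) * α) * ξ (l - a) ω := by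
  unfold weightedSum
  rw [Finset.mul_sum]
  refine Finset.sum_bij' (fun i _ => l - i) (fun a _ => l - a) ?_ ?_ ?_ ?_ ?_
  · intro i hi; rw [Finset.mem_Icc] at hi; rw [Finset.mem_range]; omega
  · intro a ha; rw [Finset.mem_range] at ha; rw [Finset.mem_Icc]; omega
  · intro i hi; rw [Finset.mem_Icc] at hi; omega
  · intro a ha; rw [Finset.mem_range] at ha; omega
  · intro i hi
    rw [Finset.mem_Icc] at hi
    change Real.exp (α * i) * ξ i ω = _
    rw [← mul_assoc, ← Real.exp_add, Nat.cast_sub hi.2, show l - (l - i) = i by omega]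
    congr 2; ring

omit [MeasurableSpace Ω] in
lemma weightedSum_exp_neg_iff (ξ : ℕ → Ω → ℝ) (α : ℝ) (l : ℕ) (ω : Ω) :
    weightedSum (fun i => Real.exp (α * (i : ℝ))) ξ l ω < 0 ↔
      ∑ a ∈ Finset.range l, Real.exp (-(a : ℝ) * α) * ξ (l - a) ω < 0 := by
  rw [weightedSum_exp_eq]
  exact ⟨fun h => (pos_iff_neg_of_mul_neg h).1 (Real.exp_pos _),
    mul_neg_of_pos_of_neg (Real.exp_pos _)⟩

/-- Time reversal of the weighted sums. -/
lemma IsStationaryGaussianSeq.measureReal_weightedSum_eq {ι : Type*} [Fintype ι]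
    (hξ : IsStationaryGaussianSeq P ξ ρ) (α : ℝ) (n : ℕ) (l : ι → ℕ) (hl : ∀ i, l i ≤ n) :
    P.real {ω | ∀ i, weightedSum (fun i => Real.exp (α * (i : ℝ))) ξ (l i) ω < 0} =
      P.real {ω | ∀ i, truncAverage α ξ (l i) (n + 1 - l i) ω < 0} := by
  simp_rw [weightedSum_exp_neg_iff]
  have h1 := hξ.weighted_vector α l (fun i a => l i - a)
  have h2 := hξ.weighted_vector α l (fun i a => n + 1 - l i + a)
  have e : ∀ i j, ∑ p ∈ Finset.range (l i) ×ˢ Finset.range (l j),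
      Real.exp (-((p.1 : ℝ) + p.2) * α) * ρ (((l i - p.1 : ℕ) : ℤ) - (l j - p.2 : ℕ)) =
      ∑ p ∈ Finset.range (l i) ×ˢ Finset.range (l j), Real.exp (-((p.1 : ℝ) + p.2) * α) *
        ρ (((n + 1 - l i + p.1 : ℕ) : ℤ) - (n + 1 - l j + p.2 : ℕ)) := by
    intro i j
    refine Finset.sum_congr rfl fun p hp => ?_
    simp only [Finset.mem_product, Finset.mem_range] at hp
    have := hl i
    have := hl j
    -- The reflection i ↦ n + 1 - i flips the sign of time differences, and ρ is even.
    rw [← hξ.even]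
    congr 2
    omega
  simp_rw [e] at h1
  exact h1.measureReal_neg_eq h2

lemma IsStationaryGaussianSeq.measureReal_weightedSum_mul_le {ι κ : Type*} [Fintype ι] [Fintype κ]
    (hξ : IsStationaryGaussianSeq P ξ ρ) (hn : ∀ k, 0 ≤ ρ k) (α : ℝ) (l : ι → ℕ) (l' : κ → ℕ) :
    P.real {ω | ∀ i, weightedSum (fun i => Real.exp (α * (i : ℝ))) ξ (l i) ω < 0} *
      P.real {ω | ∀ k, weightedSum (fun i => Real.exp (α * (i : ℝ))) ξ (l' k) ω < 0} ≤
    P.real {ω | (∀ i, weightedSum (fun i => Real.exp (α * (i : ℝ))) ξ (l i) ω < 0) ∧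
      ∀ k, weightedSum (fun i => Real.exp (α * (i : ℝ))) ξ (l' k) ω < 0} := by
  simp_rw [weightedSum_exp_neg_iff]
  have h := (hξ.weighted_vector α (Sum.elim l l') (fun i a => Sum.elim l l' i - a)).mul_le_measureReal_neg
    fun i k => Finset.sum_nonneg fun p _ => mul_nonneg (Real.exp_pos _).le (hn _)
  simpa only [Sum.forall, Sum.elim_inl, Sum.elim_inr] using h

/-- The variance is a sum of non-negative terms whose (0, 0) term is 1, so the average can be
normalized without changing its sign. -/
lemma measureReal_truncAverage_eq (hξ : IsStationaryGaussianSeq P ξ ρ) (hn : ∀ k, 0 ≤ ρ k) (α : ℝ)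
    {L : ℕ} (hL : 0 < L) (m : ℕ) :
    P.real {ω | truncAverage α ξ L m ω < 0} = (gaussianReal 0 1).real (Set.Iio 0) := by
  have h := hξ.truncAverage_vector α (fun _ : Unit => L) (fun _ => m)
  set v := ∑ p ∈ Finset.range L ×ˢ Finset.range L, expTerm α ρ ((m : ℤ) - m) p with hv
  have hvpos : 0 < v := by
    refine lt_of_lt_of_le zero_lt_one (le_trans (le_of_eq ?_) (Finset.single_le_sum
      (f := expTerm α ρ ((m : ℤ) - m)) (fun p _ => expTerm_nonneg hn _ p)
      (a := (0, 0)) (by simp [hL])))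
    simp [expTerm, hξ.unit_variance]
  have h2 := (h.smul (Real.sqrt v)⁻¹).map_eq_gaussianReal ()
  have e : ((Real.sqrt v)⁻¹ ^ 2 • (fun _ _ => v : Matrix Unit Unit ℝ)) () () = 1 := by
    simp only [Pi.smul_apply]
    rw [inv_pow, Real.sq_sqrt hvpos.le, smul_eq_mul, inv_mul_cancel₀ hvpos.ne']
  replace h2 : P.map (fun ω => (Real.sqrt v)⁻¹ * truncAverage α ξ L m ω) = gaussianReal 0 1 :=
    h2.trans (by rw [← Real.toNNReal_one]; exact congrArg (fun x => gaussianReal 0 (Real.toNNReal x)) e)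
  rw [← h2, map_measureReal_apply_of_aemeasurable ((h.smul _).aemeasurable ()) measurableSet_Iio]
  congr 1
  ext ω
  simp only [Set.mem_preimage, Set.mem_Iio, Set.mem_ofPred_eq]
  have hs : 0 < (Real.sqrt v)⁻¹ := by positivity
  exact ⟨mul_neg_of_pos_of_neg hs, fun h => (pos_iff_neg_of_mul_neg h).1 hs⟩

-- Used with `m + L` fixed: all truncations ending at the same time share one remainder, up to
-- positive factors.
omit [MeasurableSpace Ω] in
lemma truncAverage_add (α : ℝ) (ξ : ℕ → Ω → ℝ) (L K m : ℕ) (ω : Ω) :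
    truncAverage α ξ (L + K) m ω =
      truncAverage α ξ L m ω + Real.exp (-(L : ℝ) * α) * truncAverage α ξ K (m + L) ω := by
  unfold truncAverage
  rw [Finset.sum_range_add, Finset.mul_sum]
  congr 1
  refine Finset.sum_congr rfl fun a _ => ?_
  rw [← mul_assoc, ← Real.exp_add, add_assoc]
  congr 2
  push_cast; ring

/-- Comparison of the weighted sums with the stationary moving average from above. -/
lemma IsStationaryGaussianSeq.persistenceProb_weightedSum_mul_le
    (hξ : IsStationaryGaussianSeq P ξ ρ) (hα : 0 < α) (hn : ∀ k, 0 ≤ ρ k)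
    (hs : Summable fun i : ℕ => ρ i) (n : ℕ) :
    persistenceProb P (weightedSum (fun i => Real.exp (α * (i : ℝ))) ξ) n *
      (gaussianReal 0 1).real (Set.Iio 0) ≤ persistenceProb P (expAverage α ξ) n := by
  -- The common remainder is first cut to `K + 1` terms, never empty so that its probability of
  -- being negative is exactly that of a standard normal; then `K` tends to infinity.
  have key : ∀ K : ℕ, persistenceProb P (weightedSum (fun i => Real.exp (α * (i : ℝ))) ξ) n *
      (gaussianReal 0 1).real (Set.Iio 0) ≤ P.real {ω | ∀ i : Fin n,
        truncAverage α ξ (i + 1 + (K + 1)) (n + 1 - (i + 1)) ω < 0} := by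
    intro K
    have h := (hξ.truncAverage_vector α (Sum.elim (fun i : Fin n => (i : ℕ) + 1) (fun _ : Unit => K + 1))
      (Sum.elim (fun i : Fin n => n + 1 - ((i : ℕ) + 1)) (fun _ : Unit => n + 1))).mul_le_measureReal_neg
        fun i k => Finset.sum_nonneg fun p _ => expTerm_nonneg hn _ _
    rw [persistenceProb_eq_fin, hξ.measureReal_weightedSum_eq α n (fun i : Fin n => (i : ℕ) + 1)
      (fun i => by omega), ← measureReal_truncAverage_eq hξ hn α (Nat.succ_pos K) (n + 1)]
    simp only [Sum.forall, Sum.elim_inl, Sum.elim_inr, forall_const] at h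
    refine h.trans (measureReal_mono (s₂ := {ω | ∀ i : Fin n,
      truncAverage α ξ (i + 1 + (K + 1)) (n + 1 - (i + 1)) ω < 0}) ?_)
    rintro ω ⟨h1, h2⟩ i
    rw [truncAverage_add, show n + 1 - ((i : ℕ) + 1) + (i + 1) = n + 1 by omega]
    exact add_neg (h1 i) (mul_neg_of_pos_of_neg (Real.exp_pos _) h2)
  have hlim := hξ.tendsto_measureReal_truncAverage hα hn hs
    (fun i : Fin n => n + 1 - ((i : ℕ) + 1)) (L := fun K i => i + 1 + (K + 1))
    (fun i => tendsto_atTop_mono (fun K => by dsimp only [id]; omega) tendsto_id)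
  refine (ge_of_tendsto' hlim key).trans (le_of_eq ?_)
  rw [persistenceProb_eq_fin]
  congr 1
  ext ω
  simp only [Set.mem_ofPred_eq]
  constructor
  · intro h i
    have := h ⟨n - 1 - i, by omega⟩
    simpa [show n + 1 - (n - 1 - (i : ℕ) + 1) = i + 1 by omega] using this
  · intro h i
    have := h ⟨n - 1 - i, by omega⟩
    simpa [show n - 1 - (i : ℕ) + 1 = n + 1 - (i + 1) by omega] using this

/-- The persistence probabilities of blocks of the weighted sums converge to those of the
stationary moving average. -/
lemma IsStationaryGaussianSeq.tendsto_measureReal_weightedSum_block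
    (hξ : IsStationaryGaussianSeq P ξ ρ) (hα : 0 < α) (hn : ∀ k, 0 ≤ ρ k)
    (hs : Summable fun i : ℕ => ρ i) (N : ℕ) :
    Tendsto (fun m : ℕ => P.real {ω | ∀ i : Fin N,
      weightedSum (fun i => Real.exp (α * (i : ℝ))) ξ (m + (i + 1)) ω < 0}) atTop
      (𝓝 (persistenceProb P (expAverage α ξ) N)) := by
  have hlim := hξ.tendsto_measureReal_truncAverage hα hn hs
    (fun i : Fin N => N - (i : ℕ)) (L := fun m i => m + (i + 1))
    (fun i => tendsto_atTop_mono (fun m => by dsimp only [id]; omega) tendsto_id)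
  have e : persistenceProb P (expAverage α ξ) N =
      P.real {ω | ∀ i : Fin N, expAverage α ξ (N - i) ω < 0} := by
    rw [persistenceProb_eq_fin]
    congr 1
    ext ω
    simp only [Set.mem_ofPred_eq]
    constructor
    · intro h i
      have := h ⟨N - 1 - i, by omega⟩
      simpa [show N - 1 - (i : ℕ) + 1 = N - i by omega] using this
    · intro h i
      have := h ⟨N - 1 - i, by omega⟩
      simpa [show N - (N - 1 - (i : ℕ)) = i + 1 by omega] using this
  rw [e]
  refine hlim.congr fun m => ?_
  -- Time is reversed on the window `m + N`, so that the starting points `N - i` do not depend on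
  -- `m` while the lengths grow.
  rw [hξ.measureReal_weightedSum_eq α (m + N) (fun i : Fin N => m + ((i : ℕ) + 1))
    (fun i => by omega)]
  congr 1
  ext ω
  simp only [Set.mem_ofPred_eq]
  refine forall_congr' fun i => ?_
  rw [show m + N + 1 - (m + ((i : ℕ) + 1)) = N - i by omega]

lemma IsStationaryGaussianSeq.persistenceProb_weightedSum_add
    (hξ : IsStationaryGaussianSeq P ξ ρ) (hn : ∀ k, 0 ≤ ρ k) (α : ℝ) (m N : ℕ) :
    persistenceProb P (weightedSum (fun i => Real.exp (α * (i : ℝ))) ξ) m *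
      P.real {ω | ∀ i : Fin N,
        weightedSum (fun i => Real.exp (α * (i : ℝ))) ξ (m + (i + 1)) ω < 0} ≤
      persistenceProb P (weightedSum (fun i => Real.exp (α * (i : ℝ))) ξ) (m + N) := by
  rw [persistenceProb_eq_fin, persistenceProb_eq_fin]
  refine (hξ.measureReal_weightedSum_mul_le hn α (fun i : Fin m => (i : ℕ) + 1)
    (fun i : Fin N => m + ((i : ℕ) + 1))).trans (measureReal_mono ?_)
  rintro ω ⟨h1, h2⟩ i
  rcases lt_or_ge (i : ℕ) m with hi | hi
  · exact h1 ⟨i, hi⟩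
  · have := h2 ⟨i - m, by omega⟩
    simpa [show m + ((i : ℕ) - m + 1) = i + 1 by omega] using this

lemma IsStationaryGaussianSeq.persistenceProb_weightedSum_pos
    (hξ : IsStationaryGaussianSeq P ξ ρ) (hn : ∀ k, 0 ≤ ρ k) (α : ℝ) (n : ℕ) :
    0 < persistenceProb P (weightedSum (fun i => Real.exp (α * (i : ℝ))) ξ) n := by
  induction n with
  | zero => simp [persistenceProb]
  | succ n ih =>
    refine lt_of_lt_of_le (mul_pos ih ?_) (hξ.persistenceProb_weightedSum_add hn α n 1)
    rw [hξ.measureReal_weightedSum_eq α (n + 1) (fun i : Fin 1 => n + ((i : ℕ) + 1))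
      (fun i => by omega)]
    have e : {ω | ∀ i : Fin 1, truncAverage α ξ (n + ((i : ℕ) + 1))
        (n + 1 + 1 - (n + ((i : ℕ) + 1))) ω < 0} =
        {ω | truncAverage α ξ (n + 1) (n + 1 + 1 - (n + 1)) ω < 0} := by
      ext ω
      exact Fin.forall_fin_one
    rw [e, measureReal_truncAverage_eq hξ hn α (Nat.succ_pos n)]
    exact gaussianReal_real_Iio_pos 0

lemma persistenceProb_antitone (X : ℕ → Ω → ℝ) : Antitone (persistenceProb P X) := fun m n hmn =>
  measureReal_mono fun ω (hω : ∀ ℓ ∈ Finset.Icc 1 n, X ℓ ω < 0) ℓ hℓ =>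
    hω ℓ (Finset.Icc_subset_Icc_right hmn hℓ)

/-- The logarithmic decay rate of the persistence probabilities of the weighted sums. -/
theorem IsStationaryGaussianSeq.tendsto_log_persistenceProb_weightedSum
    (hξ : IsStationaryGaussianSeq P ξ ρ) (hα : 0 < α) (hn : ∀ k, 0 ≤ ρ k)
    (hs : Summable fun i : ℕ => ρ i) {θ : ℝ} (hθ0 : 0 < θ)
    (hθ : Tendsto (fun n : ℕ => -(1 / (n : ℝ) *
      Real.log (persistenceProb P (expAverage α ξ) n))) atTop (𝓝 θ)) :
    Tendsto (fun n : ℕ => Real.log (persistenceProb P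
      (weightedSum (fun i => Real.exp (α * (i : ℝ))) ξ) n) / (n : ℝ)) atTop (𝓝 (-θ)) := by
  set q := persistenceProb P (weightedSum (fun i => Real.exp (α * (i : ℝ))) ξ) with hq
  set p := persistenceProb P (expAverage α ξ) with hp
  set κ := (gaussianReal 0 1).real (Set.Iio (0 : ℝ)) with hκdef
  have hκ : 0 < κ := gaussianReal_real_Iio_pos 0
  have hqpos : ∀ n, 0 < q n := hξ.persistenceProb_weightedSum_pos hn α
  have hqp : ∀ n, q n * κ ≤ p n := hξ.persistenceProb_weightedSum_mul_le hα hn hs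
  have hppos : ∀ n, 0 < p n := fun n => (mul_pos (hqpos n) hκ).trans_le (hqp n)
  have hconst : ∀ C : ℝ, Tendsto (fun n : ℕ => C / (n : ℝ)) atTop (𝓝 0) := fun C =>
    tendsto_const_nhds.div_atTop tendsto_natCast_atTop_atTop
  refine tendsto_order.2 ⟨fun a ha => ?_, fun a ha => ?_⟩
  · obtain ⟨b, hab, hb⟩ := exists_between ha
    have hθb : θ < -b := by linarith
    obtain ⟨N, hN, hN0⟩ := ((hθ.eventually (gt_mem_nhds hθb)).and (eventually_gt_atTop 0)).exists
    have hNR : (0 : ℝ) < N := by exact_mod_cast hN0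
    have hc : Real.exp (N * b) < p N := by
      rw [← Real.lt_log_iff_exp_lt (hppos N)]
      rw [one_div, neg_lt_neg_iff, ← div_eq_inv_mul, lt_div_iff₀ hNR] at hN
      linarith
    obtain ⟨M, hM⟩ := eventually_atTop.1 ((hξ.tendsto_measureReal_weightedSum_block hα hn hs
      N).eventually (lt_mem_nhds hc))
    have hpow : ∀ k : ℕ, q M * Real.exp (N * b) ^ k ≤ q (M + k * N) := by
      intro k
      induction k with
      | zero => simp
      | succ k ih =>
        have h1 := hξ.persistenceProb_weightedSum_add hn α (M + k * N) N
        have h2 := hM (M + k * N) (Nat.le_add_right _ _)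
        rw [show M + (k + 1) * N = M + k * N + N by ring]
        refine le_trans ?_ h1
        rw [pow_succ, ← mul_assoc]
        exact mul_le_mul ih h2.le (Real.exp_pos _).le (hqpos _).le
    -- `n` is rounded up to `M` plus whole blocks, which only lowers `q`. Since `b < 0`, an upper
    -- bound on the number of blocks is what is needed.
    have hlow : ∀ n : ℕ, Real.log (q M) + (n + N) * b ≤ Real.log (q n) := by
      intro n
      have h1 : n ≤ M + (n / N + 1) * N := by
        have := Nat.lt_div_mul_add (a := n) hN0
        rw [add_mul, one_mul]; omega
      have h2 := (hpow (n / N + 1)).trans (persistenceProb_antitone _ h1)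
      have h3 := Real.log_le_log (mul_pos (hqpos M) (pow_pos (Real.exp_pos _) _)) h2
      rw [Real.log_mul (hqpos M).ne' (pow_pos (Real.exp_pos _) _).ne', Real.log_pow,
        Real.log_exp] at h3
      have h4 : ((n / N + 1 : ℕ) : ℝ) * N ≤ n + N := by
        have : (n / N + 1) * N ≤ n + N := by
          rw [add_mul, one_mul]; have := Nat.div_mul_le_self n N; omega
        exact_mod_cast this
      have h5 : b ≤ 0 := by linarith
      have h6 := mul_le_mul_of_nonpos_right h4 h5
      linarith
    have hlim : Tendsto (fun n : ℕ => (Real.log (q M) + N * b) / (n : ℝ) + b) atTop (𝓝 b) := by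
      simpa using (hconst (Real.log (q M) + N * b)).add_const b
    filter_upwards [hlim.eventually (lt_mem_nhds hab), eventually_gt_atTop 0] with n h1 h2
    have hnR : (0 : ℝ) < n := by exact_mod_cast h2
    refine h1.trans_le ?_
    rw [le_div_iff₀ hnR, add_mul, div_mul_cancel₀ _ hnR.ne']
    linarith [hlow n]
  · have hlim : Tendsto (fun n : ℕ => -(-(1 / (n : ℝ) * Real.log (p n))) + (-Real.log κ) / n) atTop
        (𝓝 (-θ)) := by
      simpa using hθ.neg.add (hconst (-Real.log κ))
    filter_upwards [hlim.eventually (gt_mem_nhds ha), eventually_gt_atTop 0] with n h1 h2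
    have hnR : (0 : ℝ) < n := by exact_mod_cast h2
    refine lt_of_le_of_lt ?_ h1
    have h3 := Real.log_le_log (mul_pos (hqpos n) hκ) (hqp n)
    rw [Real.log_mul (hqpos n).ne' hκ.ne'] at h3
    rw [neg_neg, one_div, ← div_eq_inv_mul, ← add_div]
    gcongr
    linarith

end WeightedSum

/-! ### Conclusion -/

/-- `expCorr α ρ` is a correlation function. -/
lemma IsStationaryGaussianSeq.isCorrelationFunction_expCorr {Ω : Type*} [MeasurableSpace Ω]
    {P : Measure Ω} [IsProbabilityMeasure P] {ξ : ℕ → Ω → ℝ} {ρ : ℤ → ℝ} {α : ℝ}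
    (hξ : IsStationaryGaussianSeq P ξ ρ) (hα : 0 < α) (hn : ∀ k, 0 ≤ ρ k)
    (hs : Summable fun i : ℕ => ρ i) : IsCorrelationFunction (expCorr α ρ) :=
  (hξ.expAverage_div hα hn hs).isCorrelationFunction

theorem proposition2 {Ω : Type u} [MeasurableSpace Ω] (P : Measure Ω) [IsProbabilityMeasure P]
    (ξ : ℕ → Ω → ℝ) (ρ : ℤ → ℝ) (hξ : IsStationaryGaussianSeq P ξ ρ)
    (hρ_nonneg : ∀ k : ℤ, 0 ≤ ρ k) (hρ_summable : Summable (fun i : ℕ => ρ (i : ℤ)))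
    (α : ℝ) (hα : 0 < α) :
    ∃ θ : ℝ, 0 < θ ∧
      HasPersistenceExponent.{v} (expCorr α ρ) θ ∧
      Tendsto (fun n : ℕ =>
          Real.log (persistenceProb P (weightedSum (fun i => Real.exp (α * (i : ℝ))) ξ) n) / (n : ℝ))
        atTop (𝓝 (-θ)) ∧
      (∃ (α' θ' : ℝ), 0 < α' ∧ HasPersistenceExponent.{v} (expCorr α' ρ) θ' ∧ θ' ≠ θ) ∧
      (∃ (ρ' : ℤ → ℝ) (θ' : ℝ), IsCorrelationFunction ρ' ∧ (∀ k : ℤ, 0 ≤ ρ' k) ∧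
        Summable (fun i : ℕ => ρ' (i : ℤ)) ∧
        HasPersistenceExponent.{v} (expCorr α ρ') θ' ∧ θ' ≠ θ) := by
  have he := hξ.even
  have h0 := hξ.unit_variance
  -- The exponent is needed in universe `v` for the statement and in `u` for the moving average on
  -- the space of ξ.
  obtain ⟨θ, hθ0, hθv, hθu, -⟩ :=
    (hξ.isCorrelationFunction_expCorr hα hρ_nonneg hρ_summable).exists_hasPersistenceExponent.{u, v}
      (expCorr_nonneg hρ_nonneg) (summable_expCorr hα hρ_nonneg he hρ_summable)
  -- The same `β` serves as the new parameter α' and as the parameter of the new correlation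
  -- function ρ'.
  obtain ⟨β, hβ, hsmall⟩ := exists_forall_exponent_lt.{v} hθ0
  have hcβ := hξ.isCorrelationFunction_expCorr hβ hρ_nonneg hρ_summable
  have hnβ : ∀ k, 0 ≤ expCorr β ρ k := expCorr_nonneg hρ_nonneg
  have hsβ := summable_expCorr hβ hρ_nonneg he hρ_summable
  refine ⟨θ, hθ0, hθv, ?_, ?_, ?_⟩
  · refine hξ.tendsto_log_persistenceProb_weightedSum hα hρ_nonneg hρ_summable hθ0 ?_
    simpa only [hξ.persistenceProb_expAverage_div hα hρ_nonneg hρ_summable] using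
      hθu.2 Ω P _ (hξ.expAverage_div hα hρ_nonneg hρ_summable)
  · obtain ⟨θ', hlt, hθ'⟩ := hsmall _ hcβ hnβ hsβ
      (le_expCorr hβ hρ_nonneg he hρ_summable h0)
    exact ⟨β, θ', hβ, hθ', hlt.ne⟩
  · have ⟨Ω', _, P', _, ξ', hξ'⟩ := hcβ
    obtain ⟨θ', hlt, hθ'⟩ := hsmall _ (hξ'.isCorrelationFunction_expCorr hα hnβ hsβ)
      (expCorr_nonneg hnβ) (summable_expCorr hα hnβ hξ'.even hsβ)
      (le_expCorr_expCorr hα hβ hρ_nonneg he hρ_summable h0)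
    exact ⟨expCorr β ρ, θ', hcβ, hnβ, hsβ, hθ', hlt.ne⟩
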